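/- **Setting.** An episodic MDP has a state space $\mathcal X$, a finite action set $\mathcal A$ with $A=|\mathcal A|$, horizon $H\ge 1$, a fixed initial state $x_1$, transition kernels $P_h(\cdot\mid x,a)$ and conditional cost laws $C_h(x,a)$ on $[0,1]$, $h\in[H]$. For a policy $\pi=(\pi_h:\mathcal X\to\Delta(\mathcal A))_h$, $V^\pi$ is the expectation of the cumulative cost $Z^\pi=\sum_h c_h$ when rolling in $\pi$ from $x_1$, and $V^\star=\min_\pi V^\pi$. Assume $Z^\pi\in[0,1]$ a.s. for every $\pi$. Let $\mathcal F=\mathcal F_1\times\dots\times\mathcal F_H$ be a finite class of tuples of measurable functions $f_h:\mathcal X\times\mathcal A\to[0,1]$, with $f_{H+1}=0$ and $\mathcal F_{H+1}=\{0\}$. Put $\tau^\star(g,c,x')=c+\min_{a'}g(x',a')$ and $\mathcal T^\star_hg(x,a)=\mathbb E_{c\sim C_h(x,a),\,x'\sim P_h(x,a)}[\tau^\star(g,c,x')]$. Assume that the regression targets lie in the domain of the bce loss: $\tau^\star(g,c_h,x_{h+1})\in[0,1]$ a.s. under every policy, for all $h\in[H]$, $g\in\mathcal F_{h+1}$. **Algorithm.**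 Let $\ell_{\rm bce}(\hat y,y)=-y\ln\hat y-(1-y)\ln(1-\hat y)\in[0,\infty]$ ($\ln 0=-\infty$, $0\cdot\infty=0$). In round $k=1,\dots,K$ ($K\geq 1$), with the data of rounds $i<k$, let $$\mathcal F_k=\Big\{f\in\mathcal F:\ \forall h,\ L_h(f_h,f_{h+1})-\min_{g\in\mathcal F_h}L_h(g,f_{h+1})\le\beta\Big\},\quad L_h(g,g')=\sum_{i<k}\ell_{\rm bce}\big(g(x_{h,i},a_{h,i}),\tau^\star(g',c_{h,i},x'_{h,i})\big).$$ Choose $f^k\in\arg\min_{f\in\mathcal F_k}\min_af_1(x_1,a)$ and a greedy policy $\pi^k_h(x)\in\arg\min_af^k_h(x,a)$ (ties broken arbitrarily), and gather one tuple $(x_{h,k},a_{h,k},c_{h,k},x'_{h,k})$ for each $h$: from one roll-in of $\pi^k$ if the uniform-exploration flag UA is false; from $H$ independent roll-ins, the $h$-th one following $\pi^k$ up to $x_h$ and then playing a uniformly random action, if UA is true. **Eluder dimension.** For a class $\Psi$ of functions $\mathcal S\to\mathbb R$ and a class $\mathcal M$ of distributions on $\mathcal S$, $\mathrm{EluDim}_1(\Psi,\mathcal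 M,\varepsilon_0)$ is the length of the longest sequence $\mu^{(1)},\dots,\mu^{(L)}\in\mathcal M$ such that for some $\varepsilon\ge\varepsilon_0$ and every $t\le L$ there is $\psi\in\Psi$ with $|\mathbb E_{\mu^{(t)}}\psi|>\varepsilon$ and $\sum_{i<t}|\mathbb E_{\mu^{(i)}}\psi|\le\varepsilon$. Let $h^2_{\rm Ber}(p,q)=\frac12(\sqrt p-\sqrt q)^2+\frac12(\sqrt{1-p}-\sqrt{1-q})^2$ and $\Psi_h=\{(x,a)\mapsto h^2_{\rm Ber}(f_h(x,a),\mathcal T^\star_hf_{h+1}(x,a)):f\in\mathcal F\}$, $\Psi_h^{\rm V}=\{x\mapsto\frac1A\sum_a\psi(x,a):\psi\in\Psi_h\}$; let $\mathcal M_h$ (resp. $\mathcal M^{\rm V}_h$) be the set of laws of $(x_h,a_h)$ (resp. of $x_h$) under all policies. Put $$d_{\rm bce}=\max_h\mathrm{EluDim}_1(\Psi_h,\mathcal M_h,1/K),\qquad d^{\rm V}_{\rm bce}=\max_h\mathrm{EluDim}_1(\Psi_h^{\rm V},\mathcal M_h^{\rm V},1/K).$$ **Theorem.** There is a universal constant $c>0$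 such that the following holds. Suppose $\mathcal T^\star_hg\in\mathcal F_h$ for all $h\in[H]$ and $g\in\mathcal F_{h+1}$ ($\mathcal T^\star$-Bellman completeness). Let $\delta\in(0,1)$ and $\beta=2\ln(H|\mathcal F|/\delta)$. Then with probability at least $1-\delta$, $$\sum_{k=1}^K(V^{\pi^k}-V^\star)\le c\,(1+\ln K)\Big(H\sqrt{V^\star K\,d\,\beta}+H^2d\,\beta\Big),$$ where $d=\max\{1,d_{\rm bce}\}$ if UA is false and $d=A\max\{1,d^{\rm V}_{\rm bce}\}$ if UA is true. -/

import Mathlib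

open MeasureTheory ProbabilityTheory

noncomputable section

namespace OnlineRL

/-- An episodic Markov decision process with a fixed initial state. Steps are numbered `0, 1, 2, …`
and a horizon `H` is supplied separately: only the steps `h < H` are ever executed. At step `h` in
state `x`, after action `a`, a cost `c ∼ C h (x, a)` in `[0,1]` is collected and the next state is
`x' ∼ P h (x, a)` (independently given `(x, a)`). -/
structure MDP (X A : Type*) [MeasurableSpace X] [MeasurableSpace A] where
  P : ℕ → Kernel (X × A) X
  C : ℕ → Kernel (X × A) ℝ
  x₁ : X
  markovP : ∀ h, IsMarkovKernel (P h)
  markovC : ∀ h, IsMarkovKernel (C h)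
  cost_mem : ∀ h z, ∀ᵐ c ∂(C h z), c ∈ Set.Icc (0 : ℝ) 1

/-- A (Markov, randomized) policy: `π_h : X → Δ(A)`. -/
structure Policy (X A : Type*) [MeasurableSpace X] [MeasurableSpace A] where
  ker : ℕ → Kernel X A
  markov : ∀ h, IsMarkovKernel (ker h)

attribute [instance] MDP.markovP MDP.markovC Policy.markov

/-- A transition tuple `(x, a, c, x')`. -/
abbrev Obs (X A : Type*) := X × A × ℝ × X

/-- A tuple `f = (f_0, …, f_{H-1})` of functions; entries of index `≥ H` are `0` for members of
the classes considered below. -/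
abbrev QTuple (X A : Type*) := ℕ → X → A → ℝ

section Dynamics

variable {X A : Type*} [MeasurableSpace X] [MeasurableSpace A]

/-- The law of `(a, c, x')` given the state at step `h` under `π`. -/
def MDP.stepKernel (M : MDP X A) (π : Policy X A) (h : ℕ) : Kernel X (A × ℝ × X) :=
  π.ker h ⊗ₖ (M.C h ×ₖ M.P h)

/-- The joint law of the first `n` transition tuples and of the state reached after them, when
rolling in `π` from the initial state. -/
def MDP.joint (M : MDP X A) (π : Policy X A) : (n : ℕ) → Measure ((Fin n → Obs X A) × X)
  | 0 => Measure.dirac (Fin.elim0, M.x₁)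
  | n + 1 =>
      ((M.joint π n) ⊗ₘ ((M.stepKernel π n).comap Prod.snd measurable_snd)).map
        (fun p => (Fin.snoc (α := fun _ => Obs X A) p.1.1 (p.1.2, p.2), p.2.2.2))

/-- The law of the `H` transition tuples of one roll-in of `π`. -/
def MDP.rollIn (M : MDP X A) (H : ℕ) (π : Policy X A) : Measure (Fin H → Obs X A) :=
  (M.joint π H).map Prod.fst

/-- State visitation distribution `d^π_h(x)`. -/
def MDP.stateDist (M : MDP X A) (π : Policy X A) (h : ℕ) : Measure X :=
  (M.joint π h).map Prod.snd

/-- State-action visitation distribution `d^π_h(x, a)`. -/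
def MDP.stateActionDist (M : MDP X A) (π : Policy X A) (h : ℕ) : Measure (X × A) :=
  M.stateDist π h ⊗ₘ π.ker h

/-- The cost in a transition tuple. -/
def Obs.cost (o : Obs X A) : ℝ := o.2.2.1

/-- The next state in a transition tuple. -/
def Obs.next (o : Obs X A) : X := o.2.2.2

/-- The value `V^π = E[Z^π]`, `Z^π` the cumulative cost of one roll-in of `π`. -/
def MDP.value (M : MDP X A) (H : ℕ) (π : Policy X A) : ℝ :=
  ∫ τ, ∑ h, Obs.cost (τ h) ∂(M.rollIn H π)

/-- The optimal value `V^⋆ = min_π V^π`. -/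
def MDP.optValue (M : MDP X A) (H : ℕ) : ℝ := ⨅ π : Policy X A, M.value H π

/-- The regression target `τ^⋆(g, c, x') = c + min_{a'} g(x', a')`. -/
def target (g : X → A → ℝ) (c : ℝ) (x' : X) : ℝ := c + ⨅ a' : A, g x' a'

/-- The Bellman optimality operator `T^⋆_h`. -/
def MDP.bellman (M : MDP X A) (h : ℕ) (g : X → A → ℝ) : X → A → ℝ :=
  fun x a => ∫ p, target g p.1 p.2 ∂((M.C h ×ₖ M.P h) (x, a))

/-- The law of the transition tuple at step `h` when rolling in `π` to reach `x_h` and then acting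
uniformly at random. -/
def MDP.unifObsLaw (M : MDP X A) (π : Policy X A) (h : ℕ) : Measure (Obs X A) :=
  M.stateDist π h ⊗ₘ
    ((Kernel.const X (uniformOn (Set.univ : Set A))) ⊗ₖ (M.C h ×ₖ M.P h))

/-- The law of the data set gathered in one round with policy `π`: a single roll-in without uniform
exploration; `H` independent roll-ins, the `h`-th one switching to a uniform action at step `h`,
with uniform exploration. -/
def MDP.dataLaw (M : MDP X A) (H : ℕ) (UA : Bool) (π : Policy X A) : Measure (Fin H → Obs X A) :=
  if UA then Measure.pi (fun h : Fin H => M.unifObsLaw π h) else M.rollIn H π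

end Dynamics

/-- The binary cross-entropy loss `-y ln p - (1 - y) ln (1 - p)`, with values in the extended
reals: `ln 0 = -∞` and `0 · ∞ = 0`. -/
def bceLoss (p y : ℝ) : EReal :=
  -((y : EReal) * ENNReal.log (ENNReal.ofReal p))
    - ((1 - y : ℝ) : EReal) * ENNReal.log (ENNReal.ofReal (1 - p))

/-- Squared Hellinger distance between the Bernoulli distributions with means `p` and `q`. -/
def hellBerSq (p q : ℝ) : ℝ :=
  (1 / 2) * (√p - √q) ^ 2 + (1 / 2) * (√(1 - p) - √(1 - q)) ^ 2

/-- The `ℓ_q`-eluder dimension: the length of the longest sequence `μ_0, …, μ_{L-1}` in `𝓜` such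
that for some `ε ≥ ε₀` each `μ_t` admits `ψ ∈ Ψ` with `|E_{μ_t} ψ| > ε` and
`∑_{i<t} |E_{μ_i} ψ|^q ≤ ε^q`. -/
def eluderDim {S : Type*} [MeasurableSpace S] (q : ℕ) (Ψ : Set (S → ℝ)) (𝓜 : Set (Measure S))
    (ε₀ : ℝ) : ℕ∞ :=
  sSup {L : ℕ∞ | ∃ n : ℕ, L = n ∧ ∃ μ : Fin n → Measure S, (∀ t, μ t ∈ 𝓜) ∧
    ∃ ε : ℝ, ε₀ ≤ ε ∧ ∀ t, ∃ ψ ∈ Ψ, ε < |∫ s, ψ s ∂(μ t)| ∧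
      ∑ i ∈ Finset.univ.filter (fun i => i < t), |∫ s, ψ s ∂(μ i)| ^ q ≤ ε ^ q}

section FunctionClass

variable {X A : Type*} [MeasurableSpace X] [MeasurableSpace A]

/-- A finite class `F = F_0 × ⋯ × F_{H-1}` of tuples of measurable functions `X × A → [0,1]`, with
the convention that the entry after the last step is `0`. -/
structure FunClass (X A : Type*) [MeasurableSpace X] [MeasurableSpace A] (H : ℕ) where
  fns : ℕ → Finset (X → A → ℝ)
  terminal : ∀ h, H ≤ h → fns h = {0}
  measurable : ∀ h, ∀ g ∈ fns h, Measurable (Function.uncurry g)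
  mem_Icc : ∀ h, ∀ g ∈ fns h, ∀ x a, g x a ∈ Set.Icc (0 : ℝ) 1

variable {H : ℕ}

/-- Membership of a tuple in the product class. -/
def FunClass.Mem (F : FunClass X A H) (f : QTuple X A) : Prop := ∀ h, f h ∈ F.fns h

/-- The cardinality `|F|`. -/
def FunClass.card (F : FunClass X A H) : ℕ := ∏ h ∈ Finset.range H, (F.fns h).card

/-- `T^⋆`-Bellman completeness. -/
def FunClass.BellmanComplete (F : FunClass X A H) (M : MDP X A) : Prop :=
  ∀ h < H, ∀ g ∈ F.fns (h + 1), M.bellman h g ∈ F.fns h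

/-- The pointwise Bellman error `δ^Ber_h(x, a; f) = h²_Ber(f_h(x,a), T^⋆_h f_{h+1}(x,a))`. -/
def MDP.berError (M : MDP X A) (f : QTuple X A) (h : ℕ) (x : X) (a : A) : ℝ :=
  hellBerSq (f h x a) (M.bellman h (f (h + 1)) x a)

/-- The eluder dimension `d_bce = max_h EluDim_1(Ψ_h, M_h, 1/K)`. -/
def dBce (M : MDP X A) (F : FunClass X A H) (K : ℕ) : ℕ∞ :=
  ⨆ h : Fin H, eluderDim 1
    {ψ : X × A → ℝ | ∃ f, F.Mem f ∧ ψ = fun z => M.berError f h z.1 z.2}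
    {μ | ∃ π : Policy X A, μ = M.stateActionDist π h} (1 / (K : ℝ))

/-- The V-type eluder dimension `d_bce^V = max_h EluDim_1(Ψ_h^V, M_h^V, 1/K)`. -/
def dBceV [Fintype A] (M : MDP X A) (F : FunClass X A H) (K : ℕ) : ℕ∞ :=
  ⨆ h : Fin H, eluderDim 1
    {ψ : X → ℝ | ∃ f, F.Mem f ∧ ψ = fun x => (∑ a, M.berError f h x a) / Fintype.card A}
    {μ | ∃ π : Policy X A, μ = M.stateDist π h} (1 / (K : ℝ))

/-- The complexity in the regret bound: `max {1, d_bce}` without uniform exploration, and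
`A · max {1, d_bce^V}` with it. -/
def complexity [Fintype A] (M : MDP X A) (F : FunClass X A H) (K : ℕ) (UA : Bool) : ℕ∞ :=
  if UA then (Fintype.card A : ℕ∞) * max 1 (dBceV M F K) else max 1 (dBce M F K)

/-- The empirical temporal-difference loss `L_h(g, g', D_h)` of `g` at step `h`, with targets
bootstrapped from `g'`, on the data `D 0, …, D (k-1)` of the first `k` rounds. -/
def tdLoss (loss : ℝ → ℝ → EReal) (D : ℕ → Fin H → Obs X A) (k : ℕ) (h : Fin H)
    (g g' : X → A → ℝ) : EReal :=
  ∑ i ∈ Finset.range k,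
    loss (g (D i h).1 (D i h).2.1) (target g' (Obs.cost (D i h)) (Obs.next (D i h)))

/-- The version space built from the first `k` rounds of data: the tuples `f ∈ F` with
`L_h(f_h, f_{h+1}) - min_{g ∈ F_h} L_h(g, f_{h+1}) ≤ β` at all steps `h`. -/
def versionSpace (F : FunClass X A H) (loss : ℝ → ℝ → EReal) (β : ℝ)
    (D : ℕ → Fin H → Obs X A) (k : ℕ) : Set (QTuple X A) :=
  {f | F.Mem f ∧ ∀ h : Fin H, ∀ g ∈ F.fns h,
    tdLoss loss D k h (f h) (f (h + 1)) ≤ tdLoss loss D k h g (f (h + 1)) + (β : EReal)}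

/-- `π` is a greedy deterministic policy of `f`: `π_h(x) ∈ argmin_a f_h(x, a)`. -/
def IsGreedy (H : ℕ) (f : QTuple X A) (π : Policy X A) : Prop :=
  ∀ h < H, ∃ (g : X → A) (hg : Measurable g), π.ker h = Kernel.deterministic g hg ∧
    ∀ x a, f h x (g x) ≤ f h x a

/-- A run of optimistic online RL for `K` rounds (numbered `0, …, K-1`) on the probability space
`(Ω, μ)`. The σ-algebra `ℱ k` is the information available when round `k` starts. In round `k` the
learner takes a most optimistic tuple `f k` of the version space of the data gathered so far, and
a greedy policy `π k` of it (ties broken in any way), and then gathers the data set `D k`, whose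
conditional law given `ℱ k` is the data-collection law of the policy `π k`. -/
structure IsRun {Ω : Type*} [MeasurableSpace Ω] (μ : Measure Ω) (ℱ : Filtration ℕ ‹MeasurableSpace Ω›)
    (M : MDP X A) (F : FunClass X A H) (loss : ℝ → ℝ → EReal) (β : ℝ) (K : ℕ) (UA : Bool)
    (f : ℕ → Ω → QTuple X A) (π : ℕ → Ω → Policy X A) (D : ℕ → Ω → Fin H → Obs X A) : Prop where
  predictable : ∀ k < K, ∀ g, MeasurableSet[ℱ k] {ω | f k ω = g}
  adapted : ∀ k < K, Measurable[ℱ (k + 1)] (D k)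
  mem_versionSpace : ∀ k < K, ∀ ω, f k ω ∈ versionSpace F loss β (fun i => D i ω) k
  optimistic : ∀ k < K, ∀ ω, ∀ g ∈ versionSpace F loss β (fun i => D i ω) k,
    ⨅ a, f k ω 0 M.x₁ a ≤ ⨅ a, g 0 M.x₁ a
  greedy : ∀ k < K, ∀ ω, IsGreedy H (f k ω) (π k ω)
  condLaw : ∀ k < K, ∀ S : Set (Fin H → Obs X A), MeasurableSet S →
    μ[(D k ⁻¹' S).indicator (fun _ => (1 : ℝ)) | ℱ k] =ᵐ[μ]
      fun ω => (M.dataLaw H UA (π k ω)).real S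

end FunctionClass

end OnlineRL

end

/-! All errors are measured by the squared Hellinger distance between Bernoulli laws. The bce loss
controls it statistically, and it bounds differences of means relative to their size, which is what
makes the leading term scale with `V^⋆`.

Confidence sets. Fix a step and a pair `(g, g')`. The regression target has conditional mean `T^⋆
g'`, so the root of the likelihood ratio of `g` to `T^⋆ g'` has conditional mean at most `exp (-e)`,
where `e` is the expected Hellinger error of the round (`MDP.lintegral_obsLik_le`). The product over
rounds of root ratio times `exp e` is thus a nonnegative supermartingale started at 1, and a maximal
inequality (`maximal_ineq_prod`) keeps it below `exp (β/2)` in all rounds at once, up to probability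
`exp (-β/2) = δ/(H|F|)`. A union bound covers all steps and pairs. Taking logarithms gives two facts
(`sum_bceLoss_le_and`): the backup has nearly minimal loss, so the optimal `Q`-function is never
eliminated and the learner is optimistic; and any surviving tuple has Hellinger error at most `β`
summed over past rounds.

Pigeonhole. Rounds with current error above `ε` are split greedily into about `β/ε` groups, each an
admissible sequence in the eluder dimension (`exists_coloring`). So there are at most order `dβ/ε`
of them, and integrating over `ε ≥ 1/K` bounds the total on-policy error at each step by order `dβ(1
+ ln K)` (`sum_abs_le_of_eluderDim_le`, `sum_meanError_le`).

From error to regret. By optimism and greediness, the regret of a round is at most a telescoping sum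
of on-policy Bellman residuals. Each obeys `|p - q| ≤ η(p + q) + h²/η`. With `η` of order `1/H` the
same inequality, iterated backwards, bounds all predicted values by a constant times `V^π` plus `H`
times the errors (`sum_sub_le_of_relative_error`). The regret is then bounded through `V^π` itself,
that is, through regret plus `K V^⋆`; absorbing the regret and optimising `η` gives the square root
(`le_sqrt_add_of_forall_le`). -/

noncomputable section

namespace OnlineRL

/-! ### Marginals of roll-ins and of the collected data. -/

section Dynamics

variable {X A : Type*} [MeasurableSpace X] [MeasurableSpace A]

/-- The law of the transition tuple at step `h` when rolling in `π`. -/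
def MDP.obsLaw (M : MDP X A) (π : Policy X A) (h : ℕ) : Measure (Obs X A) :=
  M.stateDist π h ⊗ₘ M.stepKernel π h

instance (M : MDP X A) (π : Policy X A) (h : ℕ) : IsMarkovKernel (M.stepKernel π h) := by
  unfold MDP.stepKernel; infer_instance

theorem measurable_snoc {α : Type*} [MeasurableSpace α] (n : ℕ) :
    Measurable (fun p : (Fin n → α) × α =>
      (Fin.snoc (α := fun _ => α) p.1 p.2 : Fin (n + 1) → α)) := by
  refine measurable_pi_iff.2 fun i => ?_
  refine Fin.lastCases ?_ (fun j => ?_) i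
  · simpa using measurable_snd
  · simp only [Fin.snoc_castSucc]
    fun_prop

theorem MDP.measurable_joint_step (n : ℕ) :
    Measurable (fun p : ((Fin n → Obs X A) × X) × (A × ℝ × X) =>
      ((Fin.snoc (α := fun _ => Obs X A) p.1.1 (p.1.2, p.2) : Fin (n + 1) → Obs X A), p.2.2.2)) := by
  have h1 : Measurable (fun p : ((Fin n → Obs X A) × X) × (A × ℝ × X) =>
      ((p.1.1, ((p.1.2, p.2) : Obs X A)))) := by fun_prop
  exact ((measurable_snoc n).comp h1).prodMk (by fun_prop)

instance MDP.isProbabilityMeasure_joint (M : MDP X A) (π : Policy X A) (n : ℕ) :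
    IsProbabilityMeasure (M.joint π n) := by
  induction n with
  | zero => unfold MDP.joint; infer_instance
  | succ n ih =>
    unfold MDP.joint
    exact Measure.isProbabilityMeasure_map (MDP.measurable_joint_step n).aemeasurable

instance (M : MDP X A) (π : Policy X A) (n : ℕ) : IsProbabilityMeasure (M.stateDist π n) :=
  Measure.isProbabilityMeasure_map measurable_snd.aemeasurable

instance (M : MDP X A) (π : Policy X A) (n : ℕ) : IsProbabilityMeasure (M.stateActionDist π n) := by
  unfold MDP.stateActionDist; infer_instance

instance (M : MDP X A) (π : Policy X A) (n : ℕ) : IsProbabilityMeasure (M.obsLaw π n) := by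
  unfold MDP.obsLaw; infer_instance

/-- The kernel reads only the last state, so forgetting the history commutes with drawing the next
transition. This reduces `joint` to one-step laws. -/
theorem compProd_comap_map_snd {α β γ : Type*} [MeasurableSpace α] [MeasurableSpace β]
    [MeasurableSpace γ] (ν : Measure (α × β)) [IsProbabilityMeasure ν] (κ : Kernel β γ)
    [IsMarkovKernel κ] :
    (ν ⊗ₘ κ.comap Prod.snd measurable_snd).map (fun p => (p.1.2, p.2)) = ν.map Prod.snd ⊗ₘ κ := by
  have : IsProbabilityMeasure (ν.map Prod.snd) :=
    Measure.isProbabilityMeasure_map measurable_snd.aemeasurable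
  ext s hs
  rw [Measure.map_apply (by fun_prop) hs, Measure.compProd_apply hs,
    Measure.compProd_apply ((show Measurable fun p : (α × β) × γ => (p.1.2, p.2) by fun_prop) hs),
    lintegral_map (Kernel.measurable_kernel_prodMk_left hs) measurable_snd]
  rfl

theorem MDP.joint_map_eval (M : MDP X A) (π : Policy X A) (n h : ℕ) (hn : h < n) :
    (M.joint π n).map (fun p => p.1 ⟨h, hn⟩) = M.obsLaw π h := by
  induction n with
  | zero => omega
  | succ n ih =>
    have hm : Measurable (fun p : (Fin (n + 1) → Obs X A) × X => p.1 ⟨h, hn⟩) := by fun_prop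
    rw [MDP.joint, Measure.map_map hm (MDP.measurable_joint_step n)]
    rcases Nat.lt_succ_iff_lt_or_eq.1 hn with hlt | rfl
    · rw [← ih hlt]
      conv_rhs => rw [← Measure.fst_compProd (M.joint π n)
        ((M.stepKernel π n).comap Prod.snd measurable_snd), Measure.fst,
        Measure.map_map (by fun_prop) measurable_fst]
      congr 1
      funext p
      exact Fin.snoc_castSucc (α := fun _ => Obs X A) _ _ (⟨h, hlt⟩ : Fin n)
    · rw [MDP.obsLaw, MDP.stateDist, ← compProd_comap_map_snd]
      congr 1
      funext p
      exact Fin.snoc_last (α := fun _ => Obs X A) _ _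

theorem MDP.rollIn_map_eval (M : MDP X A) (π : Policy X A) {H : ℕ} (h : Fin H) :
    (M.rollIn H π).map (fun τ => τ h) = M.obsLaw π h := by
  rw [MDP.rollIn, Measure.map_map (measurable_pi_apply h) measurable_fst]
  exact M.joint_map_eval π H h h.2

theorem MDP.stateDist_zero (M : MDP X A) (π : Policy X A) :
    M.stateDist π 0 = Measure.dirac M.x₁ := by
  rw [MDP.stateDist, MDP.joint]
  exact Measure.map_dirac' measurable_snd _

theorem MDP.stateDist_succ (M : MDP X A) (π : Policy X A) (h : ℕ) :
    M.stateDist π (h + 1) = (M.obsLaw π h).map Obs.next := by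
  rw [MDP.stateDist, MDP.joint, Measure.map_map measurable_snd (MDP.measurable_joint_step h),
    MDP.obsLaw, MDP.stateDist, ← compProd_comap_map_snd,
    Measure.map_map (by unfold Obs.next; fun_prop) (by fun_prop)]
  rfl

theorem MDP.obsLaw_eq_map (M : MDP X A) (π : Policy X A) (h : ℕ) :
    M.obsLaw π h =
      (M.stateActionDist π h ⊗ₘ (M.C h ×ₖ M.P h)).map MeasurableEquiv.prodAssoc := by
  rw [MDP.obsLaw, MDP.stepKernel, MDP.stateActionDist, Measure.compProd_assoc']

theorem MDP.obsLaw_map_stateAction (M : MDP X A) (π : Policy X A) (h : ℕ) :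
    (M.obsLaw π h).map (fun o => (o.1, o.2.1)) = M.stateActionDist π h := by
  rw [MDP.obsLaw_eq_map, Measure.map_map (by fun_prop) (by fun_prop)]
  exact Measure.fst_compProd _ _

theorem MDP.joint_congr (M : MDP X A) {π π' : Policy X A} (n : ℕ)
    (h : ∀ i < n, π.ker i = π'.ker i) : M.joint π n = M.joint π' n := by
  induction n with
  | zero => rfl
  | succ n ih =>
    have hs : M.stepKernel π n = M.stepKernel π' n := by
      simp only [MDP.stepKernel, h n (Nat.lt_succ_self n)]
    rw [MDP.joint, MDP.joint, ih fun i hi => h i (by omega), hs]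

theorem integral_uniformOn_univ [MeasurableSingletonClass A] [Fintype A] (g : A → ℝ) :
    ∫ a, g a ∂(uniformOn (Set.univ : Set A)) = (∑ a, g a) / Fintype.card A := by
  rw [integral_fintype (Integrable.of_finite), Finset.sum_div]
  refine Finset.sum_congr rfl fun a _ => ?_
  have : (uniformOn (Set.univ : Set A)).real {a} = 1 / Fintype.card A := by
    rw [Measure.real, uniformOn_univ]
    simp
  rw [this, smul_eq_mul]
  ring

section Explore

variable [MeasurableSingletonClass A] [Fintype A] [Nonempty A]

instance : IsProbabilityMeasure (uniformOn (Set.univ : Set A)) :=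
  isProbabilityMeasure_uniformOn Set.finite_univ Set.univ_nonempty

/-- The policy that follows `π`, except that it acts uniformly at random at step `h`. -/
def Policy.unifAt (π : Policy X A) (h : ℕ) : Policy X A where
  ker i := if i = h then Kernel.const X (uniformOn (Set.univ : Set A)) else π.ker i
  markov i := by split_ifs <;> infer_instance

instance : Nonempty (Policy X A) :=
  ⟨⟨fun _ => Kernel.const X (uniformOn (Set.univ : Set A)), fun _ => inferInstance⟩⟩

theorem MDP.stateDist_unifAt (M : MDP X A) (π : Policy X A) (h : ℕ) :
    M.stateDist (π.unifAt h) h = M.stateDist π h := by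
  rw [MDP.stateDist, MDP.stateDist, M.joint_congr (π := π.unifAt h) (π' := π)]
  intro i hi
  simp [Policy.unifAt, hi.ne]

/-- Changing the action rule at step `h` leaves the law of `x_h` alone. Exploratory data therefore
follow an ordinary roll-in of another policy: both values of the flag are treated together, and
assumptions made for all policies apply. -/
theorem MDP.unifObsLaw_eq (M : MDP X A) (π : Policy X A) (h : ℕ) :
    M.unifObsLaw π h = M.obsLaw (π.unifAt h) h := by
  rw [MDP.unifObsLaw, MDP.obsLaw, M.stateDist_unifAt, MDP.stepKernel]
  simp [Policy.unifAt]

/-- The policy whose step-`h` transition is recorded in a round with policy `π`. -/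
def Policy.explore (π : Policy X A) (UA : Bool) (h : ℕ) : Policy X A :=
  if UA then π.unifAt h else π

instance (M : MDP X A) (π : Policy X A) (h : ℕ) : IsProbabilityMeasure (M.unifObsLaw π h) := by
  rw [M.unifObsLaw_eq]; infer_instance

theorem MDP.dataLaw_map_eval (M : MDP X A) (UA : Bool) (π : Policy X A) {H : ℕ} (h : Fin H) :
    (M.dataLaw H UA π).map (fun τ => τ h) = M.obsLaw (π.explore UA h) h := by
  cases UA
  · simpa [MDP.dataLaw, Policy.explore] using M.rollIn_map_eval π h
  · have := Measure.pi_map_eval (μ := fun h : Fin H => M.unifObsLaw π h) h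
    simp only [measure_univ, Finset.prod_const_one, one_smul] at this
    simpa [MDP.dataLaw, Policy.explore, M.unifObsLaw_eq] using this

instance (M : MDP X A) (UA : Bool) (π : Policy X A) (H : ℕ) :
    IsProbabilityMeasure (M.dataLaw H UA π) := by
  unfold MDP.dataLaw
  split_ifs
  · infer_instance
  · exact Measure.isProbabilityMeasure_map measurable_fst.aemeasurable

theorem MDP.integral_stateActionDist_unifAt (M : MDP X A) (π : Policy X A) (h : ℕ)
    {ψ : X → A → ℝ} (hψ : Measurable (Function.uncurry ψ)) (B : ℝ) (hB : ∀ x a, |ψ x a| ≤ B) :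
    ∫ z, ψ z.1 z.2 ∂(M.stateActionDist (π.unifAt h) h) =
      ∫ x, (∑ a, ψ x a) / Fintype.card A ∂(M.stateDist π h) := by
  have hk : (π.unifAt h).ker h = Kernel.const X (uniformOn (Set.univ : Set A)) := by
    simp [Policy.unifAt]
  have hint : Integrable (fun z : X × A => ψ z.1 z.2) (M.stateActionDist (π.unifAt h) h) :=
    Integrable.of_bound (C := B) hψ.aestronglyMeasurable (ae_of_all _ fun z => hB z.1 z.2)
  rw [MDP.stateActionDist, Measure.integral_compProd hint, M.stateDist_unifAt]
  simp_rw [hk, Kernel.const_apply, integral_uniformOn_univ]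

end Explore

theorem MDP.integral_stateActionDist_deterministic (M : MDP X A) (π : Policy X A) (h : ℕ)
    {g : X → A} (hg : Measurable g) (hk : π.ker h = Kernel.deterministic g hg)
    {ψ : X → A → ℝ} (hψ : Measurable (Function.uncurry ψ)) (B : ℝ) (hB : ∀ x a, |ψ x a| ≤ B) :
    ∫ z, ψ z.1 z.2 ∂(M.stateActionDist π h) = ∫ x, ψ x (g x) ∂(M.stateDist π h) := by
  have hint : Integrable (fun z : X × A => ψ z.1 z.2) (M.stateActionDist π h) :=
    Integrable.of_bound (C := B) hψ.aestronglyMeasurable (ae_of_all _ fun z => hB z.1 z.2)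
  rw [MDP.stateActionDist, Measure.integral_compProd hint]
  refine integral_congr_ae (ae_of_all _ fun x => ?_)
  simp only [hk]
  exact Kernel.integral_deterministic' hg
    (hψ.comp measurable_prodMk_left).stronglyMeasurable

end Dynamics

/-! ### Likelihood ratios, Hellinger distance and the bce loss. -/

section Bernoulli

/-- The square root of the likelihood ratio `p^y (1-p)^(1-y) / (q^y (1-q)^(1-y))`. -/
def sqrtLik (p q y : ℝ) : ℝ := √(p / q) ^ y * √((1 - p) / (1 - q)) ^ (1 - y)

theorem sqrtLik_nonneg (p q y : ℝ) : 0 ≤ sqrtLik p q y := by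
  unfold sqrtLik; positivity

/-- Weighted AM-GM. The bound is affine in `y`, so its expectation depends only on the mean of `y`;
this is how fractional targets are handled like Bernoulli outcomes. -/
theorem sqrtLik_le (p q : ℝ) {y : ℝ} (hy : y ∈ Set.Icc (0 : ℝ) 1) :
    sqrtLik p q y ≤ y * √(p / q) + (1 - y) * √((1 - p) / (1 - q)) :=
  Real.geom_mean_le_arith_mean2_weighted hy.1 (by linarith [hy.2]) (Real.sqrt_nonneg _)
    (Real.sqrt_nonneg _) (by ring)

theorem mul_sqrt_div {p q : ℝ} (hq : 0 ≤ q) : q * √(p / q) = √p * √q := by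
  rcases hq.eq_or_lt with rfl | hq
  · simp
  · rw [Real.sqrt_div' _ hq.le, ← mul_div_assoc, div_eq_iff (Real.sqrt_pos.2 hq).ne']
    rw [mul_assoc, Real.mul_self_sqrt hq.le, mul_comm]

/-- The right side is the affine bound of `sqrtLik_le` at `y = q`, hence its expectation when the
target has mean `q`. Division by zero is harmless, the quotient being multiplied by its own
denominator. -/
theorem one_sub_hellBerSq {p q : ℝ} (hp : p ∈ Set.Icc (0 : ℝ) 1) (hq : q ∈ Set.Icc (0 : ℝ) 1) :
    1 - hellBerSq p q = q * √(p / q) + (1 - q) * √((1 - p) / (1 - q)) := by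
  rw [mul_sqrt_div hq.1, mul_sqrt_div (sub_nonneg.2 hq.2), hellBerSq]
  nlinarith [Real.sq_sqrt hp.1, Real.sq_sqrt hq.1, Real.sq_sqrt (sub_nonneg.2 hp.2),
    Real.sq_sqrt (sub_nonneg.2 hq.2)]

theorem hellBerSq_nonneg (p q : ℝ) : 0 ≤ hellBerSq p q := by
  unfold hellBerSq; positivity

theorem hellBerSq_le_one {p q : ℝ} (hp : p ∈ Set.Icc (0 : ℝ) 1) (hq : q ∈ Set.Icc (0 : ℝ) 1) :
    hellBerSq p q ≤ 1 := by
  have h1 : 0 ≤ q * √(p / q) := mul_nonneg hq.1 (Real.sqrt_nonneg _)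
  have h2 : 0 ≤ (1 - q) * √((1 - p) / (1 - q)) :=
    mul_nonneg (sub_nonneg.2 hq.2) (Real.sqrt_nonneg _)
  linarith [one_sub_hellBerSq hp hq]

theorem hellBerSq_self (p : ℝ) : hellBerSq p p = 0 := by simp [hellBerSq]

theorem measurable_hellBerSq : Measurable (fun z : ℝ × ℝ => hellBerSq z.1 z.2) := by
  unfold hellBerSq; fun_prop

/-- Factor `p - q` through square roots and apply AM-GM with weight `η`. The first term is
proportional to `p + q`, so it is small when both means are small. -/
theorem abs_sub_le_hellBerSq {p q η : ℝ} (hp : 0 ≤ p) (hq : 0 ≤ q) (hη : 0 < η) :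
    |p - q| ≤ η * (p + q) + hellBerSq p q / η := by
  have h1 : (√p - √q) ^ 2 ≤ 2 * hellBerSq p q := by
    unfold hellBerSq; nlinarith [sq_nonneg (√(1 - p) - √(1 - q))]
  have hpp := Real.sq_sqrt hp
  have hqq := Real.sq_sqrt hq
  have h2 : |p - q| = |√p - √q| * (√p + √q) := by
    rw [← abs_of_nonneg (add_nonneg (Real.sqrt_nonneg p) (Real.sqrt_nonneg q)), ← abs_mul]
    congr 1; linarith
  have h3 : (√p + √q) ^ 2 ≤ 2 * (p + q) := by nlinarith [sq_nonneg (√p - √q)]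
  have h4 : |√p - √q| * (√p + √q) ≤ (η * (√p + √q) ^ 2 + |√p - √q| ^ 2 / η) / 2 := by
    rw [← sub_nonneg]
    have : (η * (√p + √q) ^ 2 + |√p - √q| ^ 2 / η) / 2 - |√p - √q| * (√p + √q) =
        (η * (√p + √q) - |√p - √q|) ^ 2 / (2 * η) := by field_simp; ring
    rw [this]; positivity
  have h5 : |√p - √q| ^ 2 / η ≤ 2 * hellBerSq p q / η := by
    rw [sq_abs]; gcongr
  have h6 : 2 * hellBerSq p q / η = 2 * (hellBerSq p q / η) := by ring
  nlinarith [mul_le_mul_of_nonneg_left h3 hη.le]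

theorem bceLoss_of_pos {p y : ℝ} (hp : p ∈ Set.Icc (0 : ℝ) 1)
    (h0 : p = 0 → y = 0) (h1 : p = 1 → y = 1) :
    bceLoss p y = ((-(y * Real.log p) - (1 - y) * Real.log (1 - p) : ℝ) : EReal) := by
  have key : ∀ r t : ℝ, 0 ≤ r → (r = 0 → t = 0) →
      (t : EReal) * ENNReal.log (ENNReal.ofReal r) = ((t * Real.log r : ℝ) : EReal) := by
    intro r t hr h
    rcases hr.eq_or_lt with rfl | hr
    · simp [h rfl]
    · rw [ENNReal.log_ofReal_of_pos hr, EReal.coe_mul]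
  rw [bceLoss, key p y hp.1 h0, key (1 - p) (1 - y) (sub_nonneg.2 hp.2) fun h => by
    rw [h1 (by linarith)]; ring]
  norm_cast

theorem bceLoss_eq_top {p y : ℝ} (hy : y ∈ Set.Icc (0 : ℝ) 1)
    (h : ¬ ((p = 0 → y = 0) ∧ (p = 1 → y = 1))) : bceLoss p y = ⊤ := by
  rw [not_and_or] at h
  rcases h with h | h <;> push Not at h
  · obtain ⟨rfl, hy0⟩ := h
    have : (0 : ℝ) < y := lt_of_le_of_ne hy.1 (Ne.symm hy0)
    simp [bceLoss, EReal.coe_mul_bot_of_pos this]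
  · obtain ⟨rfl, hy1⟩ := h
    have : (0 : ℝ) < 1 - y := sub_pos.2 (lt_of_le_of_ne hy.2 hy1)
    rw [bceLoss, sub_self, ENNReal.ofReal_zero, ENNReal.log_zero, EReal.coe_mul_bot_of_pos this]
    simp

theorem bceLoss_nonneg {p y : ℝ} (hp : p ∈ Set.Icc (0 : ℝ) 1) (hy : y ∈ Set.Icc (0 : ℝ) 1) :
    0 ≤ bceLoss p y := by
  by_cases h : (p = 0 → y = 0) ∧ (p = 1 → y = 1)
  · rw [bceLoss_of_pos hp h.1 h.2]
    have h1 := mul_nonpos_of_nonneg_of_nonpos hy.1 (Real.log_nonpos hp.1 hp.2)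
    have h2 := mul_nonpos_of_nonneg_of_nonpos (sub_nonneg.2 hy.2)
      (Real.log_nonpos (sub_nonneg.2 hp.2) (by linarith [hp.1]))
    exact_mod_cast (by linarith)
  · rw [bceLoss_eq_top hy h]; exact le_top

theorem rpow_eq_exp_mul_log {r t : ℝ} (hr : 0 ≤ r) (h : r = 0 → t = 0) :
    r ^ t = Real.exp (t * Real.log r) := by
  rcases hr.eq_or_lt with rfl | hr
  · simp [h rfl]
  · rw [Real.rpow_def_of_pos hr, mul_comm]

theorem sqrt_div_rpow {p q t : ℝ} (hp : 0 ≤ p) (hq : 0 ≤ q) (hp0 : p = 0 → t = 0)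
    (hq0 : q = 0 → t = 0) :
    √(p / q) ^ t = Real.exp ((t * Real.log p - t * Real.log q) / 2) := by
  rw [Real.sqrt_div hp, Real.div_rpow (Real.sqrt_nonneg _) (Real.sqrt_nonneg _),
    rpow_eq_exp_mul_log (Real.sqrt_nonneg p) fun h => hp0 ((Real.sqrt_eq_zero hp).1 h),
    rpow_eq_exp_mul_log (Real.sqrt_nonneg q) fun h => hq0 ((Real.sqrt_eq_zero hq).1 h),
    ← Real.exp_sub, Real.log_sqrt hp, Real.log_sqrt hq]
  congr 1; ring

theorem sqrtLik_eq_exp {p q y : ℝ} (hp : p ∈ Set.Icc (0 : ℝ) 1) (hq : q ∈ Set.Icc (0 : ℝ) 1)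
    (hp0 : p = 0 → y = 0) (hp1 : p = 1 → y = 1) (hq0 : q = 0 → y = 0) (hq1 : q = 1 → y = 1) :
    sqrtLik p q y = Real.exp (((-(y * Real.log q) - (1 - y) * Real.log (1 - q)) -
      (-(y * Real.log p) - (1 - y) * Real.log (1 - p))) / 2) := by
  rw [sqrtLik, sqrt_div_rpow hp.1 hq.1 hp0 hq0,
    sqrt_div_rpow (sub_nonneg.2 hp.2) (sub_nonneg.2 hq.2)
      (fun h => by rw [hp1 (by linarith)]; ring) (fun h => by rw [hq1 (by linarith)]; ring),
    ← Real.exp_add]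
  congr 1; ring

/-- The outcome `y` has positive likelihood under the Bernoulli model with mean `q`. -/
def Admissible (q y : ℝ) : Prop := y ∈ Set.Icc (0 : ℝ) 1 ∧ (q = 0 → y = 0) ∧ (q = 1 → y = 1)

/-- With finite losses, the logarithm of `hW` reads `L(q) - L(p) + 2 ∑ e ≤ β`. Dropping `e ≥ 0`
gives the first claim; adding the assumption `L(p) ≤ L(q) + β` gives the second. -/
theorem sum_bceLoss_le_and (n : ℕ) (p q y e : ℕ → ℝ) (β : ℝ)
    (hp : ∀ i < n, p i ∈ Set.Icc (0 : ℝ) 1) (hq : ∀ i < n, q i ∈ Set.Icc (0 : ℝ) 1)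
    (hy : ∀ i < n, Admissible (q i) (y i)) (he : ∀ i < n, 0 ≤ e i)
    (hW : ∏ i ∈ Finset.range n, (sqrtLik (p i) (q i) (y i) * Real.exp (e i)) ≤ Real.exp (β / 2)) :
    (∑ i ∈ Finset.range n, bceLoss (q i) (y i) ≤
      ∑ i ∈ Finset.range n, bceLoss (p i) (y i) + (β : EReal)) ∧
    (∑ i ∈ Finset.range n, bceLoss (p i) (y i) ≤
      ∑ i ∈ Finset.range n, bceLoss (q i) (y i) + (β : EReal) →
      ∑ i ∈ Finset.range n, e i ≤ β) := by
  set s : ℕ → ℝ := fun i => -(y i * Real.log (q i)) - (1 - y i) * Real.log (1 - q i) with hs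
  set r : ℕ → ℝ := fun i => -(y i * Real.log (p i)) - (1 - y i) * Real.log (1 - p i) with hr
  have hcoe : ∀ g : ℕ → ℝ, ∑ i ∈ Finset.range n, (g i : EReal) =
      ((∑ i ∈ Finset.range n, g i : ℝ) : EReal) := by
    intro g
    induction Finset.range n using Finset.induction_on with
    | empty => simp
    | insert a t ha ih => rw [Finset.sum_insert ha, Finset.sum_insert ha, ih, EReal.coe_add]
  have hqs : ∑ i ∈ Finset.range n, bceLoss (q i) (y i) =
      ((∑ i ∈ Finset.range n, s i : ℝ) : EReal) := by
    rw [← hcoe]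
    refine Finset.sum_congr rfl fun i hi => ?_
    have hi := Finset.mem_range.1 hi
    exact bceLoss_of_pos (hq i hi) (hy i hi).2.1 (hy i hi).2.2
  by_cases hfin : ∀ i < n, (p i = 0 → y i = 0) ∧ (p i = 1 → y i = 1)
  · have hps : ∑ i ∈ Finset.range n, bceLoss (p i) (y i) =
        ((∑ i ∈ Finset.range n, r i : ℝ) : EReal) := by
      rw [← hcoe]
      refine Finset.sum_congr rfl fun i hi => ?_
      have hi := Finset.mem_range.1 hi
      exact bceLoss_of_pos (hp i hi) (hfin i hi).1 (hfin i hi).2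
    have hprod : ∏ i ∈ Finset.range n, (sqrtLik (p i) (q i) (y i) * Real.exp (e i)) =
        Real.exp (∑ i ∈ Finset.range n, ((s i - r i) / 2 + e i)) := by
      rw [Real.exp_sum]
      refine Finset.prod_congr rfl fun i hi => ?_
      have hi := Finset.mem_range.1 hi
      rw [Real.exp_add, sqrtLik_eq_exp (hp i hi) (hq i hi) (hfin i hi).1 (hfin i hi).2
        (hy i hi).2.1 (hy i hi).2.2]
    rw [hprod, Real.exp_le_exp, Finset.sum_add_distrib, ← Finset.sum_div,
      Finset.sum_sub_distrib] at hW
    have he' : 0 ≤ ∑ i ∈ Finset.range n, e i :=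
      Finset.sum_nonneg fun i hi => he i (Finset.mem_range.1 hi)
    rw [hqs, hps, ← EReal.coe_add, ← EReal.coe_add, EReal.coe_le_coe_iff, EReal.coe_le_coe_iff]
    constructor
    · linarith
    · intro h; linarith
  -- An outcome impossible under `p` makes its loss infinite, while the loss of `q` is finite by
  -- admissibility: the first claim is trivial and the premise of the second is false.
  · push Not at hfin
    obtain ⟨j, hj, hjt⟩ := hfin
    have htop : bceLoss (p j) (y j) = ⊤ :=
      bceLoss_eq_top (hy j hj).1 fun h => (hjt h.1).2 (h.2 (hjt h.1).1)
    have hps : ∑ i ∈ Finset.range n, bceLoss (p i) (y i) = ⊤ := by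
      rw [← top_le_iff, ← htop]
      exact Finset.single_le_sum (f := fun i => bceLoss (p i) (y i))
        (fun i hi => bceLoss_nonneg (hp i (Finset.mem_range.1 hi))
          (hy i (Finset.mem_range.1 hi)).1) (Finset.mem_range.2 hj)
    rw [hps, hqs, ← EReal.coe_add]
    refine ⟨by simp, fun h => absurd (top_le_iff.1 h) (EReal.coe_ne_top _)⟩

end Bernoulli

/-! ### The Bellman regression problem at one step. -/

section Regression

variable {X A : Type*} [MeasurableSpace X] [MeasurableSpace A]

theorem measurable_target [Fintype A] [MeasurableSingletonClass A] {g : X → A → ℝ}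
    (hg : Measurable (Function.uncurry g)) :
    Measurable (fun p : ℝ × X => target g p.1 p.2) := by
  unfold target
  refine measurable_fst.add (Measurable.iInf fun a => ?_)
  exact hg.comp (measurable_snd.prodMk measurable_const)

theorem MDP.ae_obsLaw_iff (M : MDP X A) (π : Policy X A) (h : ℕ) {p : X → A → ℝ × X → Prop}
    (hp : MeasurableSet {o : Obs X A | p o.1 o.2.1 o.2.2}) :
    (∀ᵐ o ∂(M.obsLaw π h), p o.1 o.2.1 o.2.2) ↔
      ∀ᵐ z ∂(M.stateActionDist π h), ∀ᵐ w ∂((M.C h ×ₖ M.P h) z), p z.1 z.2 w := by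
  rw [M.obsLaw_eq_map, ae_map_iff (MeasurableEquiv.measurable _).aemeasurable hp]
  exact Measure.ae_compProd_iff (p := fun z : (X × A) × ℝ × X => p z.1.1 z.1.2 z.2)
    ((MeasurableEquiv.prodAssoc (α := X) (β := A) (γ := ℝ × X)).measurable hp)

theorem MDP.lintegral_obsLaw (M : MDP X A) (π : Policy X A) (h : ℕ)
    {φ : Obs X A → ENNReal} (hφ : Measurable φ) :
    ∫⁻ o, φ o ∂(M.obsLaw π h) =
      ∫⁻ z, ∫⁻ w, φ (z.1, z.2, w) ∂((M.C h ×ₖ M.P h) z) ∂(M.stateActionDist π h) := by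
  rw [M.obsLaw_eq_map, lintegral_map hφ (MeasurableEquiv.measurable _)]
  exact Measure.lintegral_compProd (f := fun z : (X × A) × ℝ × X => φ (z.1.1, z.1.2, z.2))
    (hφ.comp (MeasurableEquiv.prodAssoc (α := X) (β := A) (γ := ℝ × X)).measurable)

theorem MDP.integral_obsLaw (M : MDP X A) (π : Policy X A) (h : ℕ)
    {φ : Obs X A → ℝ} (hφ : Measurable φ) (hi : Integrable φ (M.obsLaw π h)) :
    ∫ o, φ o ∂(M.obsLaw π h) =
      ∫ z, ∫ w, φ (z.1, z.2, w) ∂((M.C h ×ₖ M.P h) z) ∂(M.stateActionDist π h) := by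
  rw [M.obsLaw_eq_map] at hi ⊢
  rw [integrable_map_measure hφ.aestronglyMeasurable
    (MeasurableEquiv.measurable _).aemeasurable] at hi
  rw [integral_map (MeasurableEquiv.measurable _).aemeasurable hφ.aestronglyMeasurable]
  exact Measure.integral_compProd (f := fun z : (X × A) × ℝ × X => φ (z.1.1, z.1.2, z.2)) hi

theorem MDP.integral_stateActionDist_eq_obsLaw (M : MDP X A) (π : Policy X A) (h : ℕ)
    {ψ : X → A → ℝ} (hψ : Measurable (Function.uncurry ψ)) :
    ∫ z, ψ z.1 z.2 ∂(M.stateActionDist π h) = ∫ o, ψ o.1 o.2.1 ∂(M.obsLaw π h) := by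
  rw [← M.obsLaw_map_stateAction, integral_map (by fun_prop)
    (show Measurable fun z : X × A => ψ z.1 z.2 from hψ).aestronglyMeasurable]

theorem measurable_stateAction {ψ : X → A → ℝ} (hψ : Measurable (Function.uncurry ψ)) :
    Measurable (fun o : Obs X A => ψ o.1 o.2.1) :=
  hψ.comp (g := Function.uncurry ψ) (f := fun o : Obs X A => (o.1, o.2.1)) (by fun_prop)

theorem MDP.bellman_eq (M : MDP X A) (h : ℕ) (g : X → A → ℝ) (z : X × A) :
    M.bellman h g z.1 z.2 = ∫ w, target g w.1 w.2 ∂((M.C h ×ₖ M.P h) z) := rfl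

/-- The regression targets at step `h` under `π` lie in the unit interval. -/
def MDP.GoodTarget (M : MDP X A) (h : ℕ) (g' : X → A → ℝ) (π : Policy X A) : Prop :=
  ∀ᵐ o ∂(M.obsLaw π h), target g' (Obs.cost o) (Obs.next o) ∈ Set.Icc (0 : ℝ) 1

variable [Fintype A] [MeasurableSingletonClass A]

theorem measurable_target_obs {g : X → A → ℝ} (hg : Measurable (Function.uncurry g)) :
    Measurable (fun o : Obs X A => target g (Obs.cost o) (Obs.next o)) :=
  (measurable_target hg).comp (g := fun p : ℝ × X => target g p.1 p.2)
    (f := fun o : Obs X A => o.2.2) (by fun_prop)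

theorem MDP.GoodTarget.ae {M : MDP X A} {h : ℕ} {g' : X → A → ℝ} {π : Policy X A}
    (hg : Measurable (Function.uncurry g')) (hG : M.GoodTarget h g' π) :
    ∀ᵐ z ∂(M.stateActionDist π h), ∀ᵐ w ∂((M.C h ×ₖ M.P h) z),
      target g' w.1 w.2 ∈ Set.Icc (0 : ℝ) 1 := by
  refine (M.ae_obsLaw_iff π h (p := fun _ _ w => target g' w.1 w.2 ∈ Set.Icc (0 : ℝ) 1) ?_).1 hG
  exact measurable_target_obs hg measurableSet_Icc

theorem MDP.integrable_target {M : MDP X A} {h : ℕ} {g : X → A → ℝ}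
    (hg : Measurable (Function.uncurry g)) {z : X × A}
    (hz : ∀ᵐ w ∂((M.C h ×ₖ M.P h) z), target g w.1 w.2 ∈ Set.Icc (0 : ℝ) 1) :
    Integrable (fun w : ℝ × X => target g w.1 w.2) ((M.C h ×ₖ M.P h) z) := by
  refine Integrable.of_bound (C := 1) (measurable_target hg).aestronglyMeasurable ?_
  filter_upwards [hz] with w hw
  rw [Real.norm_eq_abs, abs_of_nonneg hw.1]
  exact hw.2

theorem MDP.measurableSet_admissible {M : MDP X A} {h : ℕ} {g' : X → A → ℝ}
    (hg : Measurable (Function.uncurry g'))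
    (hb : Measurable (Function.uncurry (M.bellman h g'))) :
    MeasurableSet {o : Obs X A |
      Admissible (M.bellman h g' o.1 o.2.1) (target g' (Obs.cost o) (Obs.next o))} := by
  have hq : Measurable fun o : Obs X A => M.bellman h g' o.1 o.2.1 :=
    measurable_stateAction hb
  have ht : Measurable fun o : Obs X A => target g' (Obs.cost o) (Obs.next o) :=
    measurable_target_obs hg
  have h0 : MeasurableSet {o : Obs X A | M.bellman h g' o.1 o.2.1 = 0 →
      target g' (Obs.cost o) (Obs.next o) = 0} :=
    MeasurableSet.imp (hq (measurableSet_singleton 0)) (ht (measurableSet_singleton 0))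
  have h1 : MeasurableSet {o : Obs X A | M.bellman h g' o.1 o.2.1 = 1 →
      target g' (Obs.cost o) (Obs.next o) = 1} :=
    MeasurableSet.imp (hq (measurableSet_singleton 1)) (ht (measurableSet_singleton 1))
  exact (ht measurableSet_Icc).inter (h0.inter h1)

/-- A variable in `[0,1]` with mean 0 or 1 is almost surely constant, so the conditional mean never
excludes the observed target. -/
theorem MDP.ae_admissible {M : MDP X A} {h : ℕ} {g' : X → A → ℝ} {π : Policy X A}
    (hg : Measurable (Function.uncurry g')) (hb : Measurable (Function.uncurry (M.bellman h g')))
    (hG : M.GoodTarget h g' π) :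
    ∀ᵐ o ∂(M.obsLaw π h),
      Admissible (M.bellman h g' o.1 o.2.1) (target g' (Obs.cost o) (Obs.next o)) := by
  refine (M.ae_obsLaw_iff π h
    (p := fun x a w => Admissible (M.bellman h g' x a) (target g' w.1 w.2))
    (measurableSet_admissible hg hb)).2 ?_
  filter_upwards [hG.ae hg] with z hz
  have hint := integrable_target hg hz
  have hzero : M.bellman h g' z.1 z.2 = 0 →
      ∀ᵐ w ∂((M.C h ×ₖ M.P h) z), target g' w.1 w.2 = 0 := by
    intro h0
    rw [M.bellman_eq, integral_eq_zero_iff_of_nonneg_ae (hz.mono fun w hw => hw.1) hint] at h0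
    exact h0
  have hone : M.bellman h g' z.1 z.2 = 1 →
      ∀ᵐ w ∂((M.C h ×ₖ M.P h) z), target g' w.1 w.2 = 1 := by
    intro h1
    have h1' : ∫ w, (1 - target g' w.1 w.2) ∂((M.C h ×ₖ M.P h) z) = 0 := by
      rw [integral_sub (integrable_const 1) hint, ← M.bellman_eq, h1]
      simp
    rw [integral_eq_zero_iff_of_nonneg_ae (hz.mono fun w hw => sub_nonneg.2 hw.2)
      ((integrable_const 1).sub hint)] at h1'
    filter_upwards [h1'] with w hw
    have : 1 - target g' w.1 w.2 = 0 := hw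
    linarith
  by_cases h0 : M.bellman h g' z.1 z.2 = 0
  · filter_upwards [hz, hzero h0] with w hw hw0
    exact ⟨hw, fun _ => hw0, fun h1 => by rw [h0] at h1; norm_num at h1⟩
  · by_cases h1 : M.bellman h g' z.1 z.2 = 1
    · filter_upwards [hz, hone h1] with w hw hw1
      exact ⟨hw, fun h => absurd h h0, fun _ => hw1⟩
    · filter_upwards [hz] with w hw
      exact ⟨hw, fun h => absurd h h0, fun h => absurd h h1⟩

/-- The square root of the likelihood ratio of the predictions `g` and `T^⋆ g'` on a tuple. -/
def MDP.obsLik (M : MDP X A) (h : ℕ) (g g' : X → A → ℝ) (o : Obs X A) : ℝ :=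
  sqrtLik (g o.1 o.2.1) (M.bellman h g' o.1 o.2.1) (target g' (Obs.cost o) (Obs.next o))

theorem MDP.measurable_obsLik {M : MDP X A} {h : ℕ} {g g' : X → A → ℝ}
    (hg : Measurable (Function.uncurry g)) (hg' : Measurable (Function.uncurry g'))
    (hb : Measurable (Function.uncurry (M.bellman h g'))) : Measurable (M.obsLik h g g') := by
  have hp : Measurable fun o : Obs X A => g o.1 o.2.1 := measurable_stateAction hg
  have hq : Measurable fun o : Obs X A => M.bellman h g' o.1 o.2.1 := measurable_stateAction hb
  have ht : Measurable fun o : Obs X A => target g' (Obs.cost o) (Obs.next o) :=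
    measurable_target_obs hg'
  unfold MDP.obsLik sqrtLik
  exact ((hp.div hq).sqrt.pow ht).mul
    (((hp.const_sub 1).div (hq.const_sub 1)).sqrt.pow (ht.const_sub 1))

/-- Conditionally on `(x, a)`, `sqrtLik_le` and `one_sub_hellBerSq` give `1 - h²`. The step `1 - t ≤
exp (-t)` comes only after averaging over `(x, a)`, so the exponent is the error of the whole
roll-in. -/
theorem MDP.lintegral_obsLik_le {M : MDP X A} {h : ℕ} {g g' : X → A → ℝ} {π : Policy X A}
    (hg : Measurable (Function.uncurry g)) (hg' : Measurable (Function.uncurry g'))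
    (hb : Measurable (Function.uncurry (M.bellman h g')))
    (hgI : ∀ x a, g x a ∈ Set.Icc (0 : ℝ) 1) (hbI : ∀ x a, M.bellman h g' x a ∈ Set.Icc (0 : ℝ) 1)
    (hG : M.GoodTarget h g' π) :
    ∫⁻ o, ENNReal.ofReal (M.obsLik h g g' o) ∂(M.obsLaw π h) ≤
      ENNReal.ofReal (Real.exp (-∫ z, hellBerSq (g z.1 z.2) (M.bellman h g' z.1 z.2)
        ∂(M.stateActionDist π h))) := by
  have hH : Measurable fun z : X × A => hellBerSq (g z.1 z.2) (M.bellman h g' z.1 z.2) :=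
    measurable_hellBerSq.comp (Measurable.prodMk hg hb)
  have hHi : Integrable (fun z : X × A => hellBerSq (g z.1 z.2) (M.bellman h g' z.1 z.2))
      (M.stateActionDist π h) := by
    refine Integrable.of_bound (C := 1) hH.aestronglyMeasurable (ae_of_all _ fun z => ?_)
    rw [Real.norm_eq_abs, abs_of_nonneg (hellBerSq_nonneg _ _)]
    exact hellBerSq_le_one (hgI _ _) (hbI _ _)
  have hHs : Integrable (fun z : X × A => 1 - hellBerSq (g z.1 z.2) (M.bellman h g' z.1 z.2))
      (M.stateActionDist π h) := (integrable_const 1).sub hHi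
  rw [M.lintegral_obsLaw π h (measurable_obsLik hg hg' hb).ennreal_ofReal]
  calc _ ≤ ∫⁻ z, ENNReal.ofReal (1 - hellBerSq (g z.1 z.2) (M.bellman h g' z.1 z.2))
        ∂(M.stateActionDist π h) := by
        refine lintegral_mono_ae ?_
        filter_upwards [hG.ae hg'] with z hz
        have hint := integrable_target hg' hz
        have hsub : Integrable (fun w : ℝ × X => 1 - target g' w.1 w.2) ((M.C h ×ₖ M.P h) z) :=
          (integrable_const 1).sub hint
        obtain ⟨p, hp⟩ : ∃ p, p = g z.1 z.2 := ⟨_, rfl⟩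
        obtain ⟨q, hq⟩ : ∃ q, q = M.bellman h g' z.1 z.2 := ⟨_, rfl⟩
        have hpI : p ∈ Set.Icc (0 : ℝ) 1 := hp ▸ hgI _ _
        have hqI : q ∈ Set.Icc (0 : ℝ) 1 := hq ▸ hbI _ _
        rw [← hp, ← hq]
        have hint2 : Integrable (fun w : ℝ × X => target g' w.1 w.2 * √(p / q) +
            (1 - target g' w.1 w.2) * √((1 - p) / (1 - q))) ((M.C h ×ₖ M.P h) z) :=
          (hint.mul_const _).add (hsub.mul_const _)
        calc _ ≤ ∫⁻ w, ENNReal.ofReal (target g' w.1 w.2 * √(p / q) +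
              (1 - target g' w.1 w.2) * √((1 - p) / (1 - q))) ∂((M.C h ×ₖ M.P h) z) := by
              refine lintegral_mono_ae ?_
              filter_upwards [hz] with w hw
              rw [hp, hq]
              exact ENNReal.ofReal_le_ofReal (sqrtLik_le _ _ hw)
          _ = ENNReal.ofReal (1 - hellBerSq p q) := by
              rw [← ofReal_integral_eq_lintegral_ofReal hint2]
              · rw [integral_add (hint.mul_const _) (hsub.mul_const _), integral_mul_const,
                  integral_mul_const, integral_sub (integrable_const 1) hint, ← M.bellman_eq,
                  ← hq, one_sub_hellBerSq hpI hqI]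
                simp
              · filter_upwards [hz] with w hw
                have := sub_nonneg.2 hw.2
                have := hw.1
                simp only [Pi.zero_apply]
                positivity
    _ = ENNReal.ofReal (∫ z, (1 - hellBerSq (g z.1 z.2) (M.bellman h g' z.1 z.2))
        ∂(M.stateActionDist π h)) := by
        rw [← ofReal_integral_eq_lintegral_ofReal hHs]
        exact ae_of_all _ fun z => sub_nonneg.2 (hellBerSq_le_one (hgI _ _) (hbI _ _))
    _ ≤ _ := by
        refine ENNReal.ofReal_le_ofReal ?_
        rw [integral_sub (integrable_const 1) hHi]
        simp only [integral_const, probReal_univ, smul_eq_mul, one_mul]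
        linarith [Real.add_one_le_exp (-∫ z, hellBerSq (g z.1 z.2) (M.bellman h g' z.1 z.2)
          ∂(M.stateActionDist π h))]

end Regression

/-! ### Conditional laws and a maximal inequality for supermartingales. -/

section Concentration

/-- `κ` is not assumed measurable, so a version measurable for `m` is built by induction on `φ`:
conditional expectations for indicators, then sums and monotone limits. Values in `ENNReal` avoid
integrability conditions. -/
theorem exists_measurable_condLaw_lintegral {Ω Y : Type*} {m mΩ : MeasurableSpace Ω}
    [MeasurableSpace Y] (hm : m ≤ mΩ) (μ : Measure Ω) [IsProbabilityMeasure μ] {D : Ω → Y}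
    (hD : Measurable D) (κ : Ω → Measure Y) [∀ ω, IsProbabilityMeasure (κ ω)]
    (hcond : ∀ S : Set Y, MeasurableSet S →
      μ[(D ⁻¹' S).indicator (fun _ => (1 : ℝ)) | m] =ᵐ[μ] fun ω => (κ ω).real S)
    {φ : Y → ENNReal} (hφ : Measurable φ) :
    ∃ ψ : Ω → ENNReal, Measurable[m] ψ ∧ (ψ =ᵐ[μ] fun ω => ∫⁻ y, φ y ∂(κ ω)) ∧
      ∀ E, MeasurableSet[m] E → ∫⁻ ω in E, φ (D ω) ∂μ = ∫⁻ ω in E, ψ ω ∂μ := by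
  refine Measurable.ennreal_induction (motive := fun φ => ∃ ψ : Ω → ENNReal, Measurable[m] ψ ∧
    (ψ =ᵐ[μ] fun ω => ∫⁻ y, φ y ∂(κ ω)) ∧
      ∀ E, MeasurableSet[m] E → ∫⁻ ω in E, φ (D ω) ∂μ = ∫⁻ ω in E, ψ ω ∂μ) ?_ ?_ ?_ hφ
  · intro c S hS
    have hDS : MeasurableSet (D ⁻¹' S) := hD hS
    set f : Ω → ℝ := (D ⁻¹' S).indicator (fun _ => (1 : ℝ))
    have hf : Integrable f μ := (integrable_const 1).indicator hDS
    refine ⟨fun ω => c * ENNReal.ofReal ((μ[f | m]) ω), ?_, ?_, fun E hE => ?_⟩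
    · exact (stronglyMeasurable_condExp.measurable.ennreal_ofReal).const_mul c
    · filter_upwards [hcond S hS] with ω hω
      rw [hω, lintegral_indicator_const hS, ofReal_measureReal]
    · have h0 : 0 ≤ᵐ[μ.restrict E] μ[f | m] := by
        refine ae_restrict_of_ae ?_
        filter_upwards [hcond S hS] with ω hω
        rw [hω]; exact measureReal_nonneg
      have h1 : ∫⁻ ω in E, ENNReal.ofReal ((μ[f | m]) ω) ∂μ = μ.restrict E (D ⁻¹' S) := by
        rw [← ofReal_integral_eq_lintegral_ofReal integrable_condExp.integrableOn h0,
          setIntegral_condExp hm hf hE, integral_indicator_const _ hDS, smul_eq_mul, mul_one,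
          ofReal_measureReal]
      rw [lintegral_const_mul _ (stronglyMeasurable_condExp.measurable.mono hm le_rfl).ennreal_ofReal,
        h1, ← lintegral_indicator_const hDS]
      rfl
  · intro f g _ hf hg ihf ihg
    obtain ⟨ψ₁, hm₁, he₁, hi₁⟩ := ihf
    obtain ⟨ψ₂, hm₂, he₂, hi₂⟩ := ihg
    refine ⟨fun ω => ψ₁ ω + ψ₂ ω, hm₁.add hm₂, ?_, fun E hE => ?_⟩
    · filter_upwards [he₁, he₂] with ω h₁ h₂
      simp only [Pi.add_apply]
      rw [h₁, h₂, lintegral_add_left hf]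
    · have hfD : Measurable fun ω => f (D ω) := hf.comp hD
      simp only [Pi.add_apply]
      rw [lintegral_add_left hfD, lintegral_add_left (hm₁.mono hm le_rfl), hi₁ E hE,
        hi₂ E hE]
  · intro f hf hmono ih
    choose ψ hψm hψe hψi using ih
    refine ⟨fun ω => ⨆ n, ψ n ω, Measurable.iSup hψm, ?_, fun E hE => ?_⟩
    · filter_upwards [ae_all_iff.2 hψe] with ω hω
      rw [lintegral_iSup hf hmono]
      exact iSup_congr hω
    · have hfD : ∀ n, Measurable fun ω => f n (D ω) := fun n => (hf n).comp hD
      rw [lintegral_iSup hfD fun i j hij ω => hmono hij (D ω),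
        lintegral_iSup_ae (fun n => (hψm n).mono hm le_rfl) fun n => ?_]
      · exact iSup_congr fun n => hψi n E hE
      · refine ae_restrict_of_ae ?_
        filter_upwards [hψe n, hψe (n + 1)] with ω h₁ h₂
        rw [h₁, Nat.succ_eq_add_one, h₂]
        exact lintegral_mono (hmono (Nat.le_succ n))

/-- Pulling out a known factor: the measures with densities `u` and `ψ` agree on `m`, hence give the
same integral to every `m`-measurable `Z`. -/
theorem lintegral_mul_eq_of_setLIntegral_eq {Ω : Type*} {m mΩ : MeasurableSpace Ω} (hm : m ≤ mΩ)
    (μ : Measure Ω) {u ψ : Ω → ENNReal} (hu : Measurable u) (hψ : Measurable ψ)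
    (h : ∀ E, MeasurableSet[m] E → ∫⁻ ω in E, u ω ∂μ = ∫⁻ ω in E, ψ ω ∂μ)
    {Z : Ω → ENNReal} (hZ : Measurable[m] Z) :
    ∫⁻ ω, Z ω * u ω ∂μ = ∫⁻ ω, Z ω * ψ ω ∂μ := by
  have hZ' : Measurable Z := hZ.mono hm le_rfl
  have htrim : (μ.withDensity u).trim hm = (μ.withDensity ψ).trim hm := by
    refine @Measure.ext _ m _ _ fun E hE => ?_
    rw [trim_measurableSet_eq hm hE, trim_measurableSet_eq hm hE,
      withDensity_apply _ (hm E hE), withDensity_apply _ (hm E hE), h E hE]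
  have h1 := lintegral_withDensity_eq_lintegral_mul μ hu hZ'
  have h2 := lintegral_withDensity_eq_lintegral_mul μ hψ hZ'
  rw [← lintegral_trim hm hZ, htrim, lintegral_trim hm hZ, h2] at h1
  simpa [mul_comm] using h1.symm

/-- Backward induction over the starting time, on events `E` known at that time. Where `W j` already
reaches `c`, Markov's inequality applies; the rest of `E` is still known at time `j`, so the
induction hypothesis followed by the supermartingale step bounds it. -/
theorem maximal_ineq_of_setLIntegral_le {Ω : Type*} {mΩ : MeasurableSpace Ω} (μ : Measure Ω)
    (ℱ : Filtration ℕ mΩ) (K : ℕ) (W : ℕ → Ω → ENNReal)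
    (hW : ∀ k ≤ K, Measurable[ℱ k] (W k))
    (hstep : ∀ k < K, ∀ E, MeasurableSet[ℱ k] E →
      ∫⁻ ω in E, W (k + 1) ω ∂μ ≤ ∫⁻ ω in E, W k ω ∂μ) (c : ENNReal) :
    c * μ {ω | ∃ k ≤ K, c ≤ W k ω} ≤ ∫⁻ ω, W 0 ω ∂μ := by
  have key : ∀ n ≤ K, ∀ E, MeasurableSet[ℱ (K - n)] E →
      c * μ (E ∩ {ω | ∃ k, K - n ≤ k ∧ k ≤ K ∧ c ≤ W k ω}) ≤ ∫⁻ ω in E, W (K - n) ω ∂μ := by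
    intro n
    induction n with
    | zero =>
      intro _ E hE
      have hset : E ∩ {ω | ∃ k, K - 0 ≤ k ∧ k ≤ K ∧ c ≤ W k ω} ⊆ E ∩ {ω | c ≤ W K ω} := by
        rintro ω ⟨hω, k, h1, h2, h3⟩
        have : k = K := by omega
        exact ⟨hω, this ▸ h3⟩
      have hmK : Measurable (W K) := (hW K le_rfl).mono (ℱ.le K) le_rfl
      have hE' : MeasurableSet E := ℱ.le _ E hE
      calc _ ≤ c * μ (E ∩ {ω | c ≤ W K ω}) := by gcongr
        _ = c * μ.restrict E {ω | c ≤ W K ω} := by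
            rw [Measure.restrict_apply (measurableSet_le measurable_const hmK), Set.inter_comm]
        _ ≤ ∫⁻ ω in E, W K ω ∂μ := mul_meas_ge_le_lintegral hmK c
    | succ n ih =>
      intro hn E hE
      have hk : K - n = K - (n + 1) + 1 := by omega
      have hm := hW (K - (n + 1)) (by omega)
      have hle := ℱ.le (K - (n + 1))
      set j := K - (n + 1) with hj
      rw [hk] at ih
      have hG : MeasurableSet[ℱ j] {ω | c ≤ W j ω} :=
        @measurableSet_le _ _ _ _ _ (ℱ j) _ _ _ _ _ (@measurable_const _ _ _ (ℱ j) c) hm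
      have hEG : MeasurableSet[ℱ j] (E \ {ω | c ≤ W j ω}) := hE.diff hG
      have hEG' : MeasurableSet[ℱ (j + 1)] (E \ {ω | c ≤ W j ω}) := ℱ.mono (Nat.le_succ j) _ hEG
      have hm' : Measurable (W j) := hm.mono hle le_rfl
      have hset : E ∩ {ω | ∃ k, j ≤ k ∧ k ≤ K ∧ c ≤ W k ω} ⊆
          (E ∩ {ω | c ≤ W j ω}) ∪
            ((E \ {ω | c ≤ W j ω}) ∩ {ω | ∃ k, j + 1 ≤ k ∧ k ≤ K ∧ c ≤ W k ω}) := by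
        rintro ω ⟨hω, k, h1, h2, h3⟩
        by_cases hc : c ≤ W j ω
        · exact Or.inl ⟨hω, hc⟩
        · refine Or.inr ⟨⟨hω, hc⟩, k, ?_, h2, h3⟩
          rcases h1.eq_or_lt with rfl | h1
          · exact absurd h3 hc
          · exact h1
      calc _ ≤ c * (μ (E ∩ {ω | c ≤ W j ω}) + μ ((E \ {ω | c ≤ W j ω}) ∩
            {ω | ∃ k, j + 1 ≤ k ∧ k ≤ K ∧ c ≤ W k ω})) := by
              gcongr; exact (measure_mono hset).trans (measure_union_le _ _)
        _ ≤ ∫⁻ ω in E ∩ {ω | c ≤ W j ω}, W j ω ∂μ + ∫⁻ ω in E \ {ω | c ≤ W j ω}, W j ω ∂μ := by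
            rw [mul_add]
            refine add_le_add ?_ ((ih (by omega) _ hEG').trans (hstep j (by omega) _ hEG))
            calc _ = ∫⁻ ω in E ∩ {ω | c ≤ W j ω}, c ∂μ := by rw [setLIntegral_const]
              _ ≤ _ := setLIntegral_mono hm' fun ω hω => hω.2
        _ = ∫⁻ ω in E, W j ω ∂μ := lintegral_inter_add_sdiff _ _ (hle _ hG)
  have := key K le_rfl Set.univ (by simp)
  simpa using this

theorem maximal_ineq_prod {Ω : Type*} {mΩ : MeasurableSpace Ω} (μ : Measure Ω)
    [IsProbabilityMeasure μ] (ℱ : Filtration ℕ mΩ) (K : ℕ) (u a ψ : ℕ → Ω → ENNReal)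
    (hu : ∀ k < K, Measurable[ℱ (k + 1)] (u k)) (ha : ∀ k < K, Measurable[ℱ k] (a k))
    (hψ : ∀ k < K, Measurable[ℱ k] (ψ k))
    (hcond : ∀ k < K, ∀ E, MeasurableSet[ℱ k] E → ∫⁻ ω in E, u k ω ∂μ = ∫⁻ ω in E, ψ k ω ∂μ)
    (hle : ∀ k < K, ∀ᵐ ω ∂μ, a k ω * ψ k ω ≤ 1) (c : ENNReal) :
    c * μ {ω | ∃ k ≤ K, c ≤ ∏ i ∈ Finset.range k, (u i ω * a i ω)} ≤ 1 := by
  have hW : ∀ k ≤ K, Measurable[ℱ k] fun ω => ∏ i ∈ Finset.range k, (u i ω * a i ω) := by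
    intro k hk
    refine Finset.measurable_fun_prod _ fun i hi => ?_
    have hi := Finset.mem_range.1 hi
    exact ((hu i (by omega)).mono (ℱ.mono hi) le_rfl).mul
      ((ha i (by omega)).mono (ℱ.mono hi.le) le_rfl)
  have := maximal_ineq_of_setLIntegral_le μ ℱ K
    (fun k ω => ∏ i ∈ Finset.range k, (u i ω * a i ω)) hW ?_ c
  · simpa using this
  intro k hk E hE
  have hE' := ℱ.le k E hE
  have hZ : Measurable[ℱ k]
      (E.indicator fun ω => (∏ i ∈ Finset.range k, (u i ω * a i ω)) * a k ω) :=
    ((hW k hk.le).mul (ha k hk)).indicator hE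
  have := lintegral_mul_eq_of_setLIntegral_eq (ℱ.le k) μ ((hu k hk).mono (ℱ.le _) le_rfl)
    ((hψ k hk).mono (ℱ.le _) le_rfl) (hcond k hk) hZ
  rw [← lintegral_indicator hE', ← lintegral_indicator hE']
  calc _ = ∫⁻ ω, E.indicator (fun ω => (∏ i ∈ Finset.range k, (u i ω * a i ω)) * a k ω) ω
        * u k ω ∂μ := by
        refine lintegral_congr fun ω => ?_
        by_cases hω : ω ∈ E
        · simp only [Set.indicator_of_mem hω, Finset.prod_range_succ]; ring
        · simp [Set.indicator_of_notMem hω]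
    _ ≤ _ := by
        rw [this]
        refine lintegral_mono_ae ?_
        filter_upwards [hle k hk] with ω hω'
        by_cases hω : ω ∈ E
        · simp only [Set.indicator_of_mem hω]
          rw [mul_assoc]
          exact mul_le_of_le_one_right' hω'
        · simp [Set.indicator_of_notMem hω]

end Concentration

/-! ### Consequences of completeness for the function class. -/

section ClassFacts

variable {X A : Type*} [MeasurableSpace X] [MeasurableSpace A] {H : ℕ}

theorem FunClass.BellmanComplete.card_pos {F : FunClass X A H} {M : MDP X A}
    (hBC : F.BellmanComplete M) (h : ℕ) : 0 < (F.fns h).card := by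
  rw [Finset.card_pos]
  by_cases hH : H ≤ h
  · rw [F.terminal h hH]; exact Finset.singleton_nonempty _
  · have key : ∀ n ≤ H, (F.fns (H - n)).Nonempty := by
      intro n
      induction n with
      | zero => intro _; rw [F.terminal _ (by omega)]; exact Finset.singleton_nonempty _
      | succ n ih =>
        intro hn
        obtain ⟨g, hg⟩ := ih (by omega)
        refine ⟨_, hBC (H - (n + 1)) (by omega) g ?_⟩
        rwa [show H - (n + 1) + 1 = H - n by omega]
    have := key (H - h) (by omega)
    rwa [show H - (H - h) = h by omega] at this

/-- Completeness makes every factor nonempty, so two factors never exceed the full product. Hence a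
union bound over pairs at one step costs only `|F|`. -/
theorem FunClass.BellmanComplete.card_mul_card_le {F : FunClass X A H} {M : MDP X A}
    (hBC : F.BellmanComplete M) {h : ℕ} (hh : h < H) :
    (F.fns h).card * (F.fns (h + 1)).card ≤ F.card := by
  have h1 : ∀ i, 1 ≤ (F.fns i).card := fun i => hBC.card_pos i
  rw [FunClass.card]
  by_cases hH : h + 1 < H
  · rw [← Finset.prod_pair (f := fun i => (F.fns i).card) (Nat.succ_ne_self h).symm]
    refine Finset.prod_le_prod_of_subset_of_one_le' ?_ fun i _ _ => h1 i
    intro i hi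
    simp only [Finset.mem_insert, Finset.mem_singleton] at hi
    simp only [Finset.mem_range]
    omega
  · rw [F.terminal (h + 1) (by omega), Finset.card_singleton, mul_one]
    exact Finset.single_le_prod' (f := fun i => (F.fns i).card) (fun i _ => h1 i)
      (Finset.mem_range.2 hh)

theorem FunClass.goodTarget [MeasurableSingletonClass A] [Fintype A] {F : FunClass X A H}
    {M : MDP X A} (hτ : ∀ π : Policy X A, ∀ h : Fin H, ∀ g ∈ F.fns (h + 1), ∀ᵐ τ ∂(M.rollIn H π),
      target g (Obs.cost (τ h)) (Obs.next (τ h)) ∈ Set.Icc (0 : ℝ) 1)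
    (π : Policy X A) (h : Fin H) {g : X → A → ℝ} (hg : g ∈ F.fns (h + 1)) :
    M.GoodTarget h g π := by
  have := hτ π h g hg
  rw [MDP.GoodTarget, ← M.rollIn_map_eval π h, ae_map_iff (f := fun τ : Fin H → Obs X A => τ h)
    (measurable_pi_apply h).aemeasurable]
  · exact this
  · exact measurable_target_obs (F.measurable _ g hg) measurableSet_Icc

end ClassFacts

/-! ### The high-probability event. -/

section GoodEvent

variable {X A Ω : Type*} [MeasurableSpace X] [MeasurableSpace A] [MeasurableSingletonClass A]
  [Fintype A] [Nonempty A] {H : ℕ}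

/-- The expected squared Hellinger error of the prediction `g` of `T^⋆ g'` on the step-`h` data of a
round with policy `π`. -/
def MDP.hellError (M : MDP X A) (UA : Bool) (h : ℕ) (g g' : X → A → ℝ) (π : Policy X A) : ℝ :=
  ∫ z, hellBerSq (g z.1 z.2) (M.bellman h g' z.1 z.2) ∂(M.stateActionDist (π.explore UA h) h)

theorem MDP.hellError_nonneg (M : MDP X A) (UA : Bool) (h : ℕ) (g g' : X → A → ℝ)
    (π : Policy X A) : 0 ≤ M.hellError UA h g g' π :=
  integral_nonneg fun _ => hellBerSq_nonneg _ _

theorem IsRun.ae_of_ae_obsLaw [mΩ : MeasurableSpace Ω] {μ : Measure Ω} [IsProbabilityMeasure μ]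
    {ℱ : Filtration ℕ mΩ} {M : MDP X A} {F : FunClass X A H} {loss : ℝ → ℝ → EReal} {β : ℝ}
    {K : ℕ} {UA : Bool} {f : ℕ → Ω → QTuple X A} {π : ℕ → Ω → Policy X A}
    {D : ℕ → Ω → Fin H → Obs X A} (hrun : IsRun μ ℱ M F loss β K UA f π D)
    (h : Fin H) {p : Obs X A → Prop} (hp : ∀ π : Policy X A, ∀ᵐ o ∂(M.obsLaw π h), p o)
    (hpm : MeasurableSet {o | p o}) :
    ∀ i < K, ∀ᵐ ω ∂μ, p (D i ω h) := by
  intro i hi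
  have hD : Measurable (D i) := (hrun.adapted i hi).mono (ℱ.le _) le_rfl
  have hφ : Measurable fun y : Fin H → Obs X A =>
      ({o | p o}ᶜ).indicator (fun _ => (1 : ENNReal)) (y h) :=
    (measurable_const.indicator hpm.compl).comp (measurable_pi_apply h)
  obtain ⟨ψ, -, hψe, hψi⟩ := exists_measurable_condLaw_lintegral (ℱ.le i) μ hD
    (fun ω => M.dataLaw H UA (π i ω)) (hrun.condLaw i hi) hφ
  have h0 : ψ =ᵐ[μ] 0 := by
    filter_upwards [hψe] with ω hω
    rw [hω, ← lintegral_map (f := fun o => ({o | p o}ᶜ).indicator (fun _ => (1 : ENNReal)) o)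
      (measurable_const.indicator hpm.compl) (measurable_pi_apply h), M.dataLaw_map_eval,
      lintegral_indicator_const hpm.compl, one_mul]
    exact hp _
  have hφD : Measurable fun ω => ({o | p o}ᶜ).indicator (fun _ => (1 : ENNReal)) (D i ω h) :=
    hφ.comp hD
  have h1 := hψi Set.univ MeasurableSet.univ
  rw [Measure.restrict_univ, lintegral_congr_ae h0, Pi.zero_def, lintegral_zero,
    lintegral_eq_zero_iff hφD] at h1
  filter_upwards [h1] with ω hω
  by_contra hcon
  have : D i ω h ∈ {o | p o}ᶜ := hcon
  simp [this] at hω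

/-- The maximal inequality applied to root likelihood ratios compensated by `exp` of the Hellinger
error; by `MDP.lintegral_obsLik_le` each factor has conditional mean at most 1. -/
theorem IsRun.measure_exists_prod_obsLik_ge [mΩ : MeasurableSpace Ω] {μ : Measure Ω}
    [IsProbabilityMeasure μ]
    {ℱ : Filtration ℕ mΩ} {M : MDP X A} {F : FunClass X A H} {loss : ℝ → ℝ → EReal} {β : ℝ}
    {K : ℕ} {UA : Bool} {f : ℕ → Ω → QTuple X A} {π : ℕ → Ω → Policy X A}
    {D : ℕ → Ω → Fin H → Obs X A} (hrun : IsRun μ ℱ M F loss β K UA f π D)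
    (h : Fin H) {g g' : X → A → ℝ}
    (hg : Measurable (Function.uncurry g)) (hg' : Measurable (Function.uncurry g'))
    (hb : Measurable (Function.uncurry (M.bellman h g')))
    (hgI : ∀ x a, g x a ∈ Set.Icc (0 : ℝ) 1) (hbI : ∀ x a, M.bellman h g' x a ∈ Set.Icc (0 : ℝ) 1)
    (hG : ∀ π, M.GoodTarget h g' π) {T : ℝ} (hT : 0 < T) :
    μ {ω | ∃ k ≤ K, T ≤ ∏ i ∈ Finset.range k,
      (M.obsLik h g g' (D i ω h) * Real.exp (M.hellError UA h g g' (π i ω)))} ≤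
      ENNReal.ofReal (1 / T) := by
  have hD : ∀ i < K, Measurable (D i) := fun i hi => (hrun.adapted i hi).mono (ℱ.le _) le_rfl
  have hLm := MDP.measurable_obsLik (M := M) (h := h) hg hg' hb
  have hφ : Measurable fun y : Fin H → Obs X A => ENNReal.ofReal (M.obsLik h g g' (y h)) :=
    (hLm.comp (measurable_pi_apply h)).ennreal_ofReal
  have hHm : Measurable fun z : X × A => hellBerSq (g z.1 z.2) (M.bellman h g' z.1 z.2) :=
    measurable_hellBerSq.comp (Measurable.prodMk hg hb)
  have hHo : Measurable fun o : Obs X A => hellBerSq (g o.1 o.2.1) (M.bellman h g' o.1 o.2.1) :=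
    measurable_hellBerSq.comp
      (Measurable.prodMk (measurable_stateAction hg) (measurable_stateAction hb))
  have hL0 : ∀ o, 0 ≤ M.obsLik h g g' o := fun o => sqrtLik_nonneg _ _ _
  have hE : Measurable fun y : Fin H → Obs X A =>
      ENNReal.ofReal (hellBerSq (g (y h).1 (y h).2.1) (M.bellman h g' (y h).1 (y h).2.1)) :=
    (hHo.comp (measurable_pi_apply h)).ennreal_ofReal
  have hEint : ∀ π : Policy X A, ∫⁻ y, ENNReal.ofReal
      (hellBerSq (g (y h).1 (y h).2.1) (M.bellman h g' (y h).1 (y h).2.1))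
        ∂(M.dataLaw H UA π) = ENNReal.ofReal (M.hellError UA h g g' π) := by
    intro π
    rw [← lintegral_map (f := fun o : Obs X A => ENNReal.ofReal
      (hellBerSq (g o.1 o.2.1) (M.bellman h g' o.1 o.2.1))) hHo.ennreal_ofReal
      (measurable_pi_apply h), M.dataLaw_map_eval, MDP.hellError,
      M.integral_stateActionDist_eq_obsLaw
        (ψ := fun x a => hellBerSq (g x a) (M.bellman h g' x a)) _ _ hHm,
      ofReal_integral_eq_lintegral_ofReal]
    · refine Integrable.of_bound (C := 1) hHo.aestronglyMeasurable (ae_of_all _ fun z => ?_)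
      rw [Real.norm_eq_abs, abs_of_nonneg (hellBerSq_nonneg _ _)]
      exact hellBerSq_le_one (hgI _ _) (hbI _ _)
    · exact ae_of_all _ fun _ => hellBerSq_nonneg _ _
  have hLint : ∀ π : Policy X A, ∫⁻ y, ENNReal.ofReal (M.obsLik h g g' (y h))
      ∂(M.dataLaw H UA π) ≤ ENNReal.ofReal (Real.exp (-M.hellError UA h g g' π)) := by
    intro π
    rw [← lintegral_map (f := fun o : Obs X A => ENNReal.ofReal (M.obsLik h g g' o))
      hLm.ennreal_ofReal (measurable_pi_apply h), M.dataLaw_map_eval]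
    exact MDP.lintegral_obsLik_le hg hg' hb hgI hbI (hG _)
  have h1 : ∀ i, ∃ ψ : Ω → ENNReal, i < K → Measurable[ℱ i] ψ ∧
      (ψ =ᵐ[μ] fun ω => ∫⁻ y, ENNReal.ofReal (M.obsLik h g g' (y h)) ∂(M.dataLaw H UA (π i ω))) ∧
      ∀ E, MeasurableSet[ℱ i] E →
        ∫⁻ ω in E, ENNReal.ofReal (M.obsLik h g g' (D i ω h)) ∂μ = ∫⁻ ω in E, ψ ω ∂μ := by
    intro i
    by_cases hi : i < K
    · obtain ⟨ψ, hψ⟩ := exists_measurable_condLaw_lintegral (ℱ.le i) μ (hD i hi)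
        (fun ω => M.dataLaw H UA (π i ω)) (hrun.condLaw i hi) hφ
      exact ⟨ψ, fun _ => hψ⟩
    · exact ⟨0, fun h => absurd h hi⟩
  -- The policy carries no measurability in `ω`. The compensator is therefore replaced by an almost
  -- surely equal version known before the round, namely a conditional expectation of the observed
  -- Hellinger error.
  have h2 : ∀ i, ∃ e : Ω → ENNReal, i < K → Measurable[ℱ i] e ∧
      (e =ᵐ[μ] fun ω => ENNReal.ofReal (M.hellError UA h g g' (π i ω))) := by
    intro i
    by_cases hi : i < K
    · obtain ⟨ψ, hψm, hψe, -⟩ := exists_measurable_condLaw_lintegral (ℱ.le i) μ (hD i hi)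
        (fun ω => M.dataLaw H UA (π i ω)) (hrun.condLaw i hi) hE
      refine ⟨ψ, fun _ => ⟨hψm, ?_⟩⟩
      filter_upwards [hψe] with ω hω
      rw [hω, hEint]
    · exact ⟨0, fun h => absurd h hi⟩
  choose ψ hψ using h1
  choose e he using h2
  have hexp : ∀ i < K, ∀ᵐ ω ∂μ, ENNReal.ofReal (Real.exp (e i ω).toReal) =
      ENNReal.ofReal (Real.exp (M.hellError UA h g g' (π i ω))) := by
    intro i hi
    filter_upwards [(he i hi).2] with ω hω
    rw [hω, ENNReal.toReal_ofReal (M.hellError_nonneg _ _ _ _ _)]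
  have hmain := maximal_ineq_prod μ ℱ K (fun i ω => ENNReal.ofReal (M.obsLik h g g' (D i ω h)))
    (fun i ω => ENNReal.ofReal (Real.exp (e i ω).toReal)) ψ
    (fun i hi => hφ.comp (hrun.adapted i hi))
    (fun i hi => (Real.measurable_exp.comp (he i hi).1.ennreal_toReal).ennreal_ofReal)
    (fun i hi => (hψ i hi).1) (fun i hi => (hψ i hi).2.2) ?_ (ENNReal.ofReal T)
  · have hsub : μ {ω | ∃ k ≤ K, T ≤ ∏ i ∈ Finset.range k,
        (M.obsLik h g g' (D i ω h) * Real.exp (M.hellError UA h g g' (π i ω)))} ≤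
        μ {ω | ∃ k ≤ K, ENNReal.ofReal T ≤ ∏ i ∈ Finset.range k,
          (ENNReal.ofReal (M.obsLik h g g' (D i ω h)) *
            ENNReal.ofReal (Real.exp (e i ω).toReal))} := by
      refine measure_mono_ae ?_
      have hall : ∀ᵐ ω ∂μ, ∀ i < K, ENNReal.ofReal (Real.exp (e i ω).toReal) =
          ENNReal.ofReal (Real.exp (M.hellError UA h g g' (π i ω))) := by
        rw [ae_all_iff]; intro i
        by_cases hi : i < K
        · filter_upwards [hexp i hi] with ω hω _ using hω
        · exact ae_of_all _ fun _ h => absurd h hi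
      filter_upwards [hall] with ω hω hmem
      obtain ⟨k, hk, hTk⟩ := hmem
      refine ⟨k, hk, ?_⟩
      refine (ENNReal.ofReal_le_ofReal hTk).trans_eq ?_
      rw [ENNReal.ofReal_prod_of_nonneg fun i _ => mul_nonneg (hL0 _) (Real.exp_pos _).le]
      refine Finset.prod_congr rfl fun i hi => ?_
      rw [hω i (lt_of_lt_of_le (Finset.mem_range.1 hi) hk),
        ENNReal.ofReal_mul (hL0 _)]
    refine hsub.trans ?_
    rw [one_div, ENNReal.ofReal_inv_of_pos hT]
    rw [ENNReal.le_inv_iff_mul_le, mul_comm]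
    exact hmain
  · intro i hi
    filter_upwards [hexp i hi, (hψ i hi).2.1] with ω h3 h4
    rw [h3, h4]
    refine (mul_le_mul_right (hLint _) _).trans ?_
    rw [← ENNReal.ofReal_mul (Real.exp_pos _).le, ← Real.exp_add]
    simp

/-- The losses of the prediction `g` and of the Bellman backup `T^⋆ g'` on the data of the first
`k ≤ K` rounds compare in the way that confidence sets need. -/
def LossesCompare (M : MDP X A) (β : ℝ) (K : ℕ) (UA : Bool) (π : ℕ → Policy X A)
    (D : ℕ → Fin H → Obs X A) (h : Fin H) (g g' : X → A → ℝ) : Prop :=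
  ∀ k ≤ K, tdLoss bceLoss D k h (M.bellman h g') g' ≤ tdLoss bceLoss D k h g g' + (β : EReal) ∧
    (tdLoss bceLoss D k h g g' ≤ tdLoss bceLoss D k h (M.bellman h g') g' + (β : EReal) →
      ∑ i ∈ Finset.range k, M.hellError UA h g g' (π i) ≤ β)

theorem IsRun.measure_not_lossesCompare_le [mΩ : MeasurableSpace Ω] {μ : Measure Ω}
    [IsProbabilityMeasure μ]
    {ℱ : Filtration ℕ mΩ} {M : MDP X A} {F : FunClass X A H} {loss : ℝ → ℝ → EReal} {β : ℝ}
    {K : ℕ} {UA : Bool} {f : ℕ → Ω → QTuple X A} {π : ℕ → Ω → Policy X A}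
    {D : ℕ → Ω → Fin H → Obs X A} (hrun : IsRun μ ℱ M F loss β K UA f π D)
    (h : Fin H) {g g' : X → A → ℝ}
    (hg : Measurable (Function.uncurry g)) (hg' : Measurable (Function.uncurry g'))
    (hb : Measurable (Function.uncurry (M.bellman h g')))
    (hgI : ∀ x a, g x a ∈ Set.Icc (0 : ℝ) 1) (hbI : ∀ x a, M.bellman h g' x a ∈ Set.Icc (0 : ℝ) 1)
    (hG : ∀ π, M.GoodTarget h g' π) (γ : ℝ) :
    μ {ω | ¬ LossesCompare M γ K UA (fun i => π i ω) (fun i => D i ω) h g g'} ≤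
      ENNReal.ofReal (1 / Real.exp (γ / 2)) := by
  refine le_trans (measure_mono_ae ?_)
    (hrun.measure_exists_prod_obsLik_ge h hg hg' hb hgI hbI hG (Real.exp_pos (γ / 2)))
  have hadm : ∀ᵐ ω ∂μ, ∀ i < K, Admissible (M.bellman h g' (D i ω h).1 (D i ω h).2.1)
      (target g' (Obs.cost (D i ω h)) (Obs.next (D i ω h))) := by
    rw [ae_all_iff]; intro i
    by_cases hi : i < K
    · filter_upwards [hrun.ae_of_ae_obsLaw h (p := fun o => Admissible (M.bellman h g' o.1 o.2.1)
        (target g' (Obs.cost o) (Obs.next o))) (fun π => MDP.ae_admissible hg' hb (hG π))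
        (MDP.measurableSet_admissible hg' hb) i hi] with ω hω _ using hω
    · exact ae_of_all _ fun _ h => absurd h hi
  filter_upwards [hadm] with ω hω hnot
  by_contra hcon
  refine hnot fun k hk => ?_
  have hlt : ¬ ∃ k ≤ K, Real.exp (γ / 2) ≤ ∏ i ∈ Finset.range k,
      (M.obsLik h g g' (D i ω h) * Real.exp (M.hellError UA h g g' (π i ω))) := hcon
  push Not at hlt
  exact sum_bceLoss_le_and k (fun i => g (D i ω h).1 (D i ω h).2.1)
    (fun i => M.bellman h g' (D i ω h).1 (D i ω h).2.1)
    (fun i => target g' (Obs.cost (D i ω h)) (Obs.next (D i ω h)))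
    (fun i => M.hellError UA h g g' (π i ω)) γ (fun i _ => hgI _ _) (fun i _ => hbI _ _)
    (fun i hi => hω i (lt_of_lt_of_le hi hk)) (fun i _ => M.hellError_nonneg _ _ _ _ _)
    (hlt k hk).le

theorem IsRun.measure_exists_not_lossesCompare_le [mΩ : MeasurableSpace Ω] {μ : Measure Ω}
    [IsProbabilityMeasure μ]
    {ℱ : Filtration ℕ mΩ} {M : MDP X A} {F : FunClass X A H} {loss : ℝ → ℝ → EReal} {β : ℝ}
    {K : ℕ} {UA : Bool} {f : ℕ → Ω → QTuple X A} {π : ℕ → Ω → Policy X A}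
    {D : ℕ → Ω → Fin H → Obs X A} (hrun : IsRun μ ℱ M F loss β K UA f π D) (hH : 1 ≤ H)
    (hτ : ∀ π : Policy X A, ∀ h : Fin H, ∀ g ∈ F.fns (h + 1), ∀ᵐ τ ∂(M.rollIn H π),
      target g (Obs.cost (τ h)) (Obs.next (τ h)) ∈ Set.Icc (0 : ℝ) 1)
    (hBC : F.BellmanComplete M) {δ : ℝ} (hδ : 0 < δ) :
    μ {ω | ¬ ∀ h : Fin H, ∀ g ∈ F.fns h, ∀ g' ∈ F.fns (h + 1),
      LossesCompare M (2 * Real.log (H * F.card / δ)) K UA (fun i => π i ω) (fun i => D i ω)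
        h g g'} ≤ ENNReal.ofReal δ := by
  set γ := 2 * Real.log (H * F.card / δ) with hγ
  have hcard : 1 ≤ F.card := Finset.one_le_prod' fun i _ => hBC.card_pos i
  have hHc : (0 : ℝ) < H * F.card := by
    have h1 : (0 : ℝ) < H := by exact_mod_cast hH
    have h2 : (0 : ℝ) < F.card := by exact_mod_cast hcard
    positivity
  -- The factor 2 in the threshold cancels the square root taken of the likelihood ratio.
  have hexp : 1 / Real.exp (γ / 2) = δ / (H * F.card) := by
    rw [hγ, mul_div_cancel_left₀ _ (two_ne_zero' ℝ), Real.exp_log (by positivity), one_div_div]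
  have hsub : {ω | ¬ ∀ h : Fin H, ∀ g ∈ F.fns h, ∀ g' ∈ F.fns (h + 1),
      LossesCompare M γ K UA (fun i => π i ω) (fun i => D i ω) h g g'} ⊆
      ⋃ h ∈ (Finset.univ : Finset (Fin H)), ⋃ p ∈ F.fns h ×ˢ F.fns (h + 1),
        {ω | ¬ LossesCompare M γ K UA (fun i => π i ω) (fun i => D i ω) h p.1 p.2} := by
    intro ω hω
    simp only [Set.mem_ofPred_eq, not_forall] at hω
    obtain ⟨h, g, hg, g', hg', hn⟩ := hω
    simp only [Set.mem_iUnion]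
    exact ⟨h, Finset.mem_univ _, (g, g'), Finset.mk_mem_product hg hg', hn⟩
  refine (measure_mono hsub).trans ((measure_biUnion_finset_le _ _).trans ?_)
  calc _ ≤ ∑ _h : Fin H, F.card • ENNReal.ofReal (δ / (H * F.card)) := by
        refine Finset.sum_le_sum fun h _ => ?_
        refine (measure_biUnion_finset_le _ _).trans ?_
        refine (Finset.sum_le_card_nsmul _ _ (ENNReal.ofReal (δ / (H * F.card))) ?_).trans ?_
        · intro p hp
          obtain ⟨hp1, hp2⟩ := Finset.mem_product.1 hp
          rw [← hexp]
          have hb := hBC h h.2 p.2 hp2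
          exact hrun.measure_not_lossesCompare_le h (F.measurable _ _ hp1) (F.measurable _ _ hp2)
            (F.measurable _ _ hb) (F.mem_Icc _ _ hp1) (F.mem_Icc _ _ hb)
            (fun π => F.goodTarget hτ π h hp2) γ
        · rw [Finset.card_product]
          exact nsmul_le_nsmul_left zero_le (hBC.card_mul_card_le h.2)
    _ = ENNReal.ofReal δ := by
        rw [Finset.sum_const, Finset.card_univ, Fintype.card_fin, smul_smul, ← ENNReal.ofReal_nsmul]
        congr 1
        rw [nsmul_eq_mul]
        push_cast
        field_simp

end GoodEvent

/-! ### Pigeonhole bounds from the eluder dimension. -/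

section Eluder

theorem card_le_of_eluderDim_le {S : Type*} [MeasurableSpace S] {Ψ : Set (S → ℝ)}
    {𝓜 : Set (Measure S)} {ε₀ ε : ℝ} {N : ℕ} (hN : eluderDim 1 Ψ 𝓜 ε₀ ≤ N) (hε : ε₀ ≤ ε)
    (T : Finset ℕ) (μ : ℕ → Measure S) (ψ : ℕ → S → ℝ) (hμ : ∀ k ∈ T, μ k ∈ 𝓜)
    (hψ : ∀ k ∈ T, ψ k ∈ Ψ) (hlarge : ∀ k ∈ T, ε < |∫ s, ψ k s ∂(μ k)|)
    (hsmall : ∀ k ∈ T, ∑ i ∈ T.filter (· < k), |∫ s, ψ k s ∂(μ i)| ≤ ε) : T.card ≤ N := by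
  have hle : ((T.card : ℕ) : ℕ∞) ≤ eluderDim 1 Ψ 𝓜 ε₀ := by
    refine le_sSup ⟨T.card, rfl, fun t => μ (T.orderEmbOfFin rfl t),
      fun t => hμ _ (T.orderEmbOfFin_mem rfl t), ε, hε, fun t =>
      ⟨ψ (T.orderEmbOfFin rfl t), hψ _ (T.orderEmbOfFin_mem rfl t),
        hlarge _ (T.orderEmbOfFin_mem rfl t), ?_⟩⟩
    simp only [pow_one]
    refine le_trans (le_of_eq ?_) (hsmall _ (T.orderEmbOfFin_mem rfl t))
    have himg : T.filter (· < T.orderEmbOfFin rfl t) =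
        (Finset.univ.filter (fun i => i < t)).map (T.orderEmbOfFin rfl).toEmbedding := by
      ext k
      simp only [Finset.mem_filter, Finset.mem_map, Finset.mem_univ, true_and]
      constructor
      · rintro ⟨hk, hlt⟩
        have : k ∈ Set.range (T.orderEmbOfFin rfl) := by
          rw [Finset.range_orderEmbOfFin]; exact hk
        obtain ⟨i, rfl⟩ := this
        exact ⟨i, (T.orderEmbOfFin rfl).lt_iff_lt.1 hlt, rfl⟩
      · rintro ⟨i, hi, rfl⟩
        exact ⟨T.orderEmbOfFin_mem rfl i, (T.orderEmbOfFin rfl).lt_iff_lt.2 hi⟩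
    rw [himg, Finset.sum_map]
    rfl
  exact_mod_cast hle.trans hN

/-- If the errors of every large index sum to at most `β` over the preceding indices, the large
indices can be coloured with `m > β / ε` colours so that they sum to at most `ε` within a colour. -/
theorem exists_coloring (e : ℕ → ℕ → ℝ) (he : ∀ k i, 0 ≤ e k i) {ε β : ℝ} {m : ℕ}
    (hm : β < m * ε) (K : ℕ) (p : ℕ → Prop) [DecidablePred p]
    (hsum : ∀ k < K, ∑ i ∈ Finset.range k, e k i ≤ β) :
    ∃ c : ℕ → ℕ, (∀ k < K, c k < m) ∧ ∀ k < K, p k →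
      ∑ i ∈ (Finset.range k).filter (fun i => p i ∧ c i = c k), e k i ≤ ε := by
  induction K with
  | zero => exact ⟨fun _ => 0, by simp⟩
  | succ K ih =>
    obtain ⟨c, hc, hcs⟩ := ih fun k hk => hsum k (by omega)
    -- Greedy choice: if every colour class already had error above `ε`, the classes together would
    -- exceed `m * ε > β`.
    obtain ⟨j, hj, hjs⟩ : ∃ j < m,
        ∑ i ∈ (Finset.range K).filter (fun i => p i ∧ c i = j), e K i ≤ ε := by
      by_contra hcon
      push Not at hcon
      have h1 : (m : ℝ) * ε ≤ ∑ j ∈ Finset.range m,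
          ∑ i ∈ (Finset.range K).filter (fun i => p i ∧ c i = j), e K i := by
        rw [← nsmul_eq_mul, ← Finset.card_range m, ← Finset.sum_const, Finset.card_range]
        exact Finset.sum_le_sum fun j hj => (hcon j (Finset.mem_range.1 hj)).le
      have h2 : ∑ j ∈ Finset.range m,
          ∑ i ∈ (Finset.range K).filter (fun i => p i ∧ c i = j), e K i ≤
          ∑ i ∈ Finset.range K, e K i := by
        calc _ ≤ ∑ j ∈ Finset.range m,
              ∑ i ∈ (Finset.range K).filter (fun i => c i = j), e K i := by
              refine Finset.sum_le_sum fun j _ => ?_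
              refine Finset.sum_le_sum_of_subset_of_nonneg ?_ fun i _ _ => he K i
              intro i hi
              simp only [Finset.mem_filter] at hi ⊢
              exact ⟨hi.1, hi.2.2⟩
          _ = _ := Finset.sum_fiberwise_of_maps_to
              (fun i hi => Finset.mem_range.2 (hc i (Finset.mem_range.1 hi))) _
      linarith [hsum K (by omega)]
    refine ⟨Function.update c K j, fun k hk => ?_, fun k hk hp => ?_⟩
    · rcases Nat.lt_succ_iff_lt_or_eq.1 hk with h | rfl
      · rw [Function.update_of_ne h.ne]; exact hc k h
      · rwa [Function.update_self]
    · have hne : ∀ i ∈ Finset.range k, Function.update c K j i = c i := fun i hi => by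
        rw [Function.update_of_ne]
        have := Finset.mem_range.1 hi
        omega
      rw [Finset.filter_congr fun i hi => by rw [hne i hi]]
      rcases Nat.lt_succ_iff_lt_or_eq.1 hk with h | rfl
      · rw [Function.update_of_ne h.ne]; exact hcs k h hp
      · rwa [Function.update_self]

/-- Use `⌊β/ε⌋ + 1` colours. Within a colour, each large index has small total error on its
predecessors, so a colour class has at most `N` elements. -/
theorem card_large_le_of_eluderDim_le {S : Type*} [MeasurableSpace S] {Ψ : Set (S → ℝ)}
    {𝓜 : Set (Measure S)} {ε₀ ε β : ℝ} {N : ℕ} (hN : eluderDim 1 Ψ 𝓜 ε₀ ≤ N) (hε : ε₀ ≤ ε)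
    (hε0 : 0 < ε) (hβ : 0 ≤ β) (K : ℕ) (μ : ℕ → Measure S) (ψ : ℕ → S → ℝ)
    (hμ : ∀ k < K, μ k ∈ 𝓜) (hψ : ∀ k < K, ψ k ∈ Ψ)
    (hsum : ∀ k < K, ∑ i ∈ Finset.range k, |∫ s, ψ k s ∂(μ i)| ≤ β) :
    (((Finset.range K).filter (fun k => ε < |∫ s, ψ k s ∂(μ k)|)).card : ℝ) ≤
      (β / ε + 1) * N := by
  classical
  obtain ⟨c, hc, hcs⟩ := exists_coloring (fun k i => |∫ s, ψ k s ∂(μ i)|) (fun _ _ => abs_nonneg _)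
    (ε := ε) (β := β) (m := ⌊β / ε⌋₊ + 1) (by
      push_cast
      have := Nat.lt_floor_add_one (β / ε)
      rwa [div_lt_iff₀ hε0] at this) K (fun k => ε < |∫ s, ψ k s ∂(μ k)|) hsum
  set L := (Finset.range K).filter (fun k => ε < |∫ s, ψ k s ∂(μ k)|) with hL
  have hcard : L.card ≤ N * (Finset.range (⌊β / ε⌋₊ + 1)).card := by
    refine Finset.card_le_mul_card_image_of_maps_to (f := c) (fun k hk => ?_) N fun j _ => ?_
    · exact Finset.mem_range.2 (hc k (Finset.mem_range.1 (Finset.mem_filter.1 hk).1))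
    · refine card_le_of_eluderDim_le hN hε _ μ ψ (fun k hk => ?_) (fun k hk => ?_)
        (fun k hk => ?_) fun k hk => ?_
      all_goals
        simp only [hL, Finset.mem_filter, Finset.mem_range] at hk
        obtain ⟨⟨hkK, hkl⟩, hkc⟩ := hk
      · exact hμ k hkK
      · exact hψ k hkK
      · exact hkl
      · refine le_trans (le_of_eq ?_) (hcs k hkK hkl)
        refine Finset.sum_congr ?_ fun _ _ => rfl
        ext i
        simp only [hL, Finset.mem_filter, Finset.mem_range]
        constructor
        · rintro ⟨⟨⟨_, h1⟩, h2⟩, h3⟩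
          exact ⟨h3, h1, h2.trans hkc.symm⟩
        · rintro ⟨h3, h1, h2⟩
          exact ⟨⟨⟨h3.trans hkK, h1⟩, h2.trans hkc⟩, h3⟩
  calc (L.card : ℝ) ≤ ((N * (⌊β / ε⌋₊ + 1) : ℕ) : ℝ) := by
        rw [Finset.card_range] at hcard; exact_mod_cast hcard
    _ = (⌊β / ε⌋₊ + 1) * N := by push_cast; ring
    _ ≤ _ := by gcongr; exact Nat.floor_le (by positivity)

/-- Remove the smallest value first. In a set of size `n`, a minimum above `2/K` is at most `2B/n`,
because all `n` values exceed half of it; summing over `n` gives the harmonic number. -/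
theorem sum_le_of_card_large_le (a : ℕ → ℝ) (K : ℕ) (hK : 1 ≤ K) {B : ℝ} (hB : 0 ≤ B)
    (T : Finset ℕ)
    (hcount : ∀ ε : ℝ, 1 / (K : ℝ) ≤ ε → ((T.filter (fun k => ε < a k)).card : ℝ) ≤ B / ε) :
    ∑ k ∈ T, a k ≤ T.card * (2 / (K : ℝ)) + 2 * B * (harmonic T.card : ℝ) := by
  have hK0 : (0 : ℝ) < K := by exact_mod_cast hK
  induction T using Finset.induction_on_min_value a with
  | empty => simp
  | insert k s hk hmin ih =>
    have hs := ih fun ε hε => le_trans (by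
      gcongr
      exact Finset.subset_insert _ _) (hcount ε hε)
    rw [Finset.sum_insert hk, Finset.card_insert_of_notMem hk, harmonic_succ]
    push_cast
    have hak : a k ≤ 2 / K + 2 * B / (s.card + 1) := by
      have hpos : 0 ≤ 2 * B / ((s.card : ℝ) + 1) := by positivity
      by_cases h : a k ≤ 2 / K
      · linarith
      · push Not at h
        have hak0 : 0 < a k := lt_trans (by positivity) h
        -- Halving makes the minimum itself pass the strict threshold while keeping the level at
        -- least `1/K`.
        have h1 := hcount (a k / 2) (by
          rw [le_div_iff₀ two_pos]; refine le_trans (le_of_eq ?_) h.le; ring)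
        rw [Finset.filter_true_of_mem, Finset.card_insert_of_notMem hk] at h1
        · push_cast at h1
          have : a k ≤ 2 * B / (s.card + 1) := by
            rw [le_div_iff₀ (by positivity)] at h1 ⊢
            linarith
          have : (0 : ℝ) ≤ 2 / K := by positivity
          linarith
        · intro i hi
          rcases Finset.mem_insert.1 hi with rfl | hi
          · linarith
          · linarith [hmin i hi]
    have : 2 * B / ((s.card : ℝ) + 1) = 2 * B * ((s.card : ℝ) + 1)⁻¹ := by ring
    linarith

/-- The eluder pigeonhole bound. -/
theorem sum_abs_le_of_eluderDim_le {S : Type*} [MeasurableSpace S] {Ψ : Set (S → ℝ)}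
    {𝓜 : Set (Measure S)} {β : ℝ} {N K : ℕ} (hK : 1 ≤ K)
    (hN : eluderDim 1 Ψ 𝓜 (1 / (K : ℝ)) ≤ N) (hN1 : 1 ≤ N) (hβ : 1 ≤ β) (μ : ℕ → Measure S)
    (ψ : ℕ → S → ℝ) (hμ : ∀ k < K, μ k ∈ 𝓜) (hψ : ∀ k < K, ψ k ∈ Ψ)
    (hsum : ∀ k < K, ∑ i ∈ Finset.range k, |∫ s, ψ k s ∂(μ i)| ≤ β)
    (hle : ∀ k < K, |∫ s, ψ k s ∂(μ k)| ≤ 1) :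
    ∑ k ∈ Finset.range K, |∫ s, ψ k s ∂(μ k)| ≤ 6 * (N * β * (1 + Real.log K)) := by
  have hK0 : (0 : ℝ) < K := by exact_mod_cast hK
  have hN' : (1 : ℝ) ≤ N := by exact_mod_cast hN1
  have hlog : 0 ≤ Real.log K := Real.log_nonneg (by exact_mod_cast hK)
  have h := sum_le_of_card_large_le (fun k => |∫ s, ψ k s ∂(μ k)|) K hK
    (B := 2 * β * N) (by positivity) (Finset.range K) fun ε hε => by
      have hε0 : 0 < ε := lt_of_lt_of_le (by positivity) hε
      -- Below level 1, `β ≥ 1` absorbs the `+ 1` of the colour count; from level 1 on there are no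
      -- large values.
      by_cases h1 : ε < 1
      · refine (card_large_le_of_eluderDim_le hN hε hε0 (by linarith) K μ ψ hμ hψ hsum).trans ?_
        have : β / ε + 1 ≤ 2 * β / ε := by
          rw [div_add_one hε0.ne']
          gcongr
          linarith
        calc _ ≤ 2 * β / ε * N := by gcongr
          _ = _ := by ring
      · rw [Finset.filter_false_of_mem]
        · simp only [Finset.card_empty, Nat.cast_zero]; positivity
        · intro k hk
          have := hle k (Finset.mem_range.1 hk)
          simp only [not_lt]; linarith
  rw [Finset.card_range] at h
  have hh : (harmonic K : ℝ) ≤ 1 + Real.log K := harmonic_le_one_add_log K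
  have h2 : (K : ℝ) * (2 / K) = 2 := by field_simp
  have h3 : 2 * (2 * β * N) * (harmonic K : ℝ) ≤ 2 * (2 * β * N) * (1 + Real.log K) := by gcongr
  have h4 : 1 ≤ N * β * (1 + Real.log K) := by
    have : 1 ≤ N * β := one_le_mul_of_one_le_of_one_le hN' hβ
    exact one_le_mul_of_one_le_of_one_le this (by linarith)
  linarith

end Eluder

/-! ### Minimisation over actions. -/

section ActionMin

variable {X A : Type*} [Fintype A] [Nonempty A]

theorem iInf_action_mem_Icc {g : X → A → ℝ} (hg : ∀ x a, g x a ∈ Set.Icc (0 : ℝ) 1) (x : X) :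
    ⨅ a, g x a ∈ Set.Icc (0 : ℝ) 1 := by
  obtain ⟨a⟩ := ‹Nonempty A›
  exact ⟨Real.iInf_nonneg fun a => (hg x a).1,
    (ciInf_le (Set.finite_range _).bddBelow a).trans (hg x a).2⟩

theorem iInf_action_eq {g : X → A → ℝ} {x : X} {a : A} (ha : ∀ b, g x a ≤ g x b) :
    ⨅ b, g x b = g x a :=
  le_antisymm (ciInf_le (Set.finite_range _).bddBelow a) (le_ciInf ha)

end ActionMin

/-! ### Values, optimism and Bellman residuals under a policy. -/

section Regret

variable {X A : Type*} [MeasurableSpace X] [MeasurableSpace A]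

theorem Obs.measurable_cost : Measurable (Obs.cost : Obs X A → ℝ) := by
  unfold Obs.cost; fun_prop

theorem Obs.measurable_next : Measurable (Obs.next : Obs X A → X) := by
  unfold Obs.next; fun_prop

theorem MDP.ae_cost_mem (M : MDP X A) (π : Policy X A) (h : ℕ) :
    ∀ᵐ o ∂(M.obsLaw π h), Obs.cost o ∈ Set.Icc (0 : ℝ) 1 := by
  refine (M.ae_obsLaw_iff π h (p := fun _ _ w => w.1 ∈ Set.Icc (0 : ℝ) 1)
    (Obs.measurable_cost measurableSet_Icc)).2 (ae_of_all _ fun z => ?_)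
  rw [Kernel.prod_apply]
  exact Measure.quasiMeasurePreserving_fst.ae (M.cost_mem h z)

theorem MDP.integrable_cost (M : MDP X A) (π : Policy X A) (h : ℕ) :
    Integrable Obs.cost (M.obsLaw π h) := by
  refine Integrable.of_bound (C := 1) Obs.measurable_cost.aestronglyMeasurable ?_
  filter_upwards [M.ae_cost_mem π h] with o ho
  rw [Real.norm_eq_abs, abs_of_nonneg ho.1]
  exact ho.2

/-- The expected cost of step `h`. -/
def MDP.meanCost (M : MDP X A) (π : Policy X A) (h : ℕ) : ℝ := ∫ o, Obs.cost o ∂(M.obsLaw π h)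

theorem MDP.meanCost_nonneg (M : MDP X A) (π : Policy X A) (h : ℕ) : 0 ≤ M.meanCost π h :=
  integral_nonneg_of_ae ((M.ae_cost_mem π h).mono fun _ ho => ho.1)

theorem MDP.value_eq_sum (M : MDP X A) (H : ℕ) (π : Policy X A) :
    M.value H π = ∑ h ∈ Finset.range H, M.meanCost π h := by
  rw [MDP.value, integral_finsetSum, ← Fin.sum_univ_eq_sum_range]
  · refine Finset.sum_congr rfl fun h _ => ?_
    rw [MDP.meanCost, ← M.rollIn_map_eval π h, integral_map
      (measurable_pi_apply h).aemeasurable Obs.measurable_cost.aestronglyMeasurable]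
  · intro h _
    have := M.integrable_cost π h
    rw [← M.rollIn_map_eval π h] at this
    exact this.comp_measurable (measurable_pi_apply h)

theorem MDP.value_nonneg (M : MDP X A) (H : ℕ) (π : Policy X A) : 0 ≤ M.value H π := by
  rw [M.value_eq_sum]
  exact Finset.sum_nonneg fun h _ => M.meanCost_nonneg π h

theorem MDP.optValue_nonneg (M : MDP X A) (H : ℕ) : 0 ≤ M.optValue H :=
  Real.iInf_nonneg fun π => M.value_nonneg H π

theorem MDP.optValue_le (M : MDP X A) (H : ℕ) (π : Policy X A) : M.optValue H ≤ M.value H π :=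
  ciInf_le ⟨0, by rintro _ ⟨π, rfl⟩; exact M.value_nonneg H π⟩ π

theorem measurable_iInf_action [Fintype A] {g : X → A → ℝ} (hg : Measurable (Function.uncurry g)) :
    Measurable (fun x => ⨅ a, g x a) :=
  Measurable.iInf fun a => hg.comp (g := Function.uncurry g) (f := fun x => (x, a)) (by fun_prop)

/-- The expectation of `min_a g(x_h, a)` under `π`. -/
def MDP.meanMin (M : MDP X A) (π : Policy X A) (h : ℕ) (g : X → A → ℝ) : ℝ :=
  ∫ x, ⨅ a, g x a ∂(M.stateDist π h)

theorem MDP.meanMin_zero [Nonempty A] (M : MDP X A) (π : Policy X A) (h : ℕ) :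
    M.meanMin π h (0 : X → A → ℝ) = 0 := by
  simp [MDP.meanMin]

variable {H : ℕ}

theorem FunClass.Mem.terminal_eq {F : FunClass X A H} {f : QTuple X A} (hf : F.Mem f) :
    f H = 0 := by
  have := hf H
  rwa [F.terminal H le_rfl, Finset.mem_singleton] at this

/-- The optimal `Q`-function. -/
def MDP.optQ (M : MDP X A) (H : ℕ) (h : ℕ) : X → A → ℝ :=
  if h < H then M.bellman h (M.optQ H (h + 1)) else 0
termination_by H - h

theorem MDP.optQ_eq (M : MDP X A) {h : ℕ} (hh : h < H) :
    M.optQ H h = M.bellman h (M.optQ H (h + 1)) := by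
  rw [MDP.optQ, if_pos hh]

/-- The expected pointwise Bellman error at step `h` under `π`. -/
def MDP.meanError (M : MDP X A) (π : Policy X A) (f : QTuple X A) (h : ℕ) : ℝ :=
  ∫ z, M.berError f h z.1 z.2 ∂(M.stateActionDist π h)

theorem MDP.meanError_nonneg (M : MDP X A) (π : Policy X A) (f : QTuple X A) (h : ℕ) :
    0 ≤ M.meanError π f h := integral_nonneg fun _ => hellBerSq_nonneg _ _

theorem FunClass.BellmanComplete.measurable_berError {F : FunClass X A H} {M : MDP X A}
    (hBC : F.BellmanComplete M) {f : QTuple X A} (hf : F.Mem f) {h : ℕ} (hh : h < H) :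
    Measurable (Function.uncurry (M.berError f h)) :=
  measurable_hellBerSq.comp (Measurable.prodMk (F.measurable _ _ (hf h))
    (F.measurable _ _ (hBC h hh _ (hf (h + 1)))))

theorem FunClass.BellmanComplete.berError_mem {F : FunClass X A H} {M : MDP X A}
    (hBC : F.BellmanComplete M) {f : QTuple X A} (hf : F.Mem f) {h : ℕ} (hh : h < H) (x : X)
    (a : A) : M.berError f h x a ∈ Set.Icc (0 : ℝ) 1 :=
  ⟨hellBerSq_nonneg _ _, hellBerSq_le_one (F.mem_Icc _ _ (hf h) _ _)
    (F.mem_Icc _ _ (hBC h hh _ (hf (h + 1))) _ _)⟩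

theorem integrable_of_mem_Icc {Y : Type*} [MeasurableSpace Y] {ν : Measure Y}
    [IsFiniteMeasure ν] {φ : Y → ℝ} (hφ : Measurable φ) (h : ∀ y, φ y ∈ Set.Icc (0 : ℝ) 1) :
    Integrable φ ν := by
  refine Integrable.of_bound (C := 1) hφ.aestronglyMeasurable (ae_of_all _ fun y => ?_)
  rw [Real.norm_eq_abs, abs_of_nonneg (h y).1]
  exact (h y).2

theorem MDP.integral_bellman [MeasurableSingletonClass A] [Fintype A] [Nonempty A]
    (M : MDP X A) (π : Policy X A) (h : ℕ) {g : X → A → ℝ}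
    (hg : Measurable (Function.uncurry g)) (hgI : ∀ x a, g x a ∈ Set.Icc (0 : ℝ) 1)
    (hG : M.GoodTarget h g π) :
    ∫ z, M.bellman h g z.1 z.2 ∂(M.stateActionDist π h) =
      M.meanCost π h + M.meanMin π (h + 1) g := by
  have hmin := measurable_iInf_action hg
  have hint : Integrable (fun o : Obs X A => target g (Obs.cost o) (Obs.next o))
      (M.obsLaw π h) := by
    refine Integrable.of_bound (C := 1) (measurable_target_obs hg).aestronglyMeasurable ?_
    filter_upwards [hG] with o ho
    rw [Real.norm_eq_abs, abs_of_nonneg ho.1]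
    exact ho.2
  have hminI : Integrable (fun o : Obs X A => ⨅ a, g (Obs.next o) a) (M.obsLaw π h) :=
    integrable_of_mem_Icc (hmin.comp Obs.measurable_next) fun o => iInf_action_mem_Icc hgI _
  have h1 := M.integral_obsLaw π h (measurable_target_obs hg) hint
  calc _ = ∫ o, target g (Obs.cost o) (Obs.next o) ∂(M.obsLaw π h) := h1.symm
    _ = _ := by
      unfold target
      rw [integral_add (M.integrable_cost π h) hminI, MDP.meanCost, MDP.meanMin,
        M.stateDist_succ, integral_map Obs.measurable_next.aemeasurable hmin.aestronglyMeasurable]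

theorem MDP.meanMin_le [Fintype A] [Nonempty A]
    (M : MDP X A) (π : Policy X A) (h : ℕ) {g : X → A → ℝ}
    (hg : Measurable (Function.uncurry g)) (hgI : ∀ x a, g x a ∈ Set.Icc (0 : ℝ) 1) :
    M.meanMin π h g ≤ ∫ z, g z.1 z.2 ∂(M.stateActionDist π h) := by
  have hmin := measurable_iInf_action hg
  have hfst : M.stateDist π h = (M.stateActionDist π h).map Prod.fst :=
    (Measure.fst_compProd _ _).symm
  rw [MDP.meanMin, hfst, integral_map measurable_fst.aemeasurable hmin.aestronglyMeasurable]
  refine integral_mono ?_ (integrable_of_mem_Icc hg fun z => hgI _ _) fun z => ?_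
  · exact integrable_of_mem_Icc (hmin.comp measurable_fst) fun z => iInf_action_mem_Icc hgI _
  · exact ciInf_le (Set.finite_range _).bddBelow z.2

theorem MDP.meanMin_zero_step [Fintype A]
    (M : MDP X A) (π : Policy X A) {g : X → A → ℝ}
    (hg : Measurable (Function.uncurry g)) : M.meanMin π 0 g = ⨅ a, g M.x₁ a := by
  rw [MDP.meanMin, M.stateDist_zero,
    integral_dirac' _ _ (measurable_iInf_action hg).stronglyMeasurable]

theorem MDP.meanMin_nonneg [Fintype A] [Nonempty A]
    (M : MDP X A) (π : Policy X A) (h : ℕ) {g : X → A → ℝ}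
    (hgI : ∀ x a, g x a ∈ Set.Icc (0 : ℝ) 1) : 0 ≤ M.meanMin π h g :=
  integral_nonneg fun x => (iInf_action_mem_Icc hgI x).1

theorem FunClass.BellmanComplete.mem_optQ {F : FunClass X A H} {M : MDP X A}
    (hBC : F.BellmanComplete M) : F.Mem (M.optQ H) := by
  have h0 : ∀ h, H ≤ h → M.optQ H h ∈ F.fns h := fun h hh => by
    rw [MDP.optQ, if_neg (by omega), F.terminal h hh]
    exact Finset.mem_singleton_self _
  intro h
  by_cases hh : H ≤ h
  · exact h0 h hh
  · have hle : h ≤ H := by omega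
    induction hle using Nat.decreasingInduction with
    | self => exact h0 H le_rfl
    | of_succ k hk ih =>
      rw [M.optQ_eq hk]
      refine hBC k hk _ ?_
      by_cases hk' : H ≤ k + 1
      · exact h0 _ hk'
      · exact ih hk'

/-- Under any policy, the mean of the minimum is at most the mean of the backup, which is the mean
cost plus the next minimum. Telescoping compares with every policy; no optimal policy need be
constructed. -/
theorem FunClass.BellmanComplete.iInf_optQ_le [MeasurableSingletonClass A] [Fintype A] [Nonempty A]
    {F : FunClass X A H} {M : MDP X A}
    (hBC : F.BellmanComplete M)
    (hG : ∀ π : Policy X A, ∀ h : Fin H, ∀ g ∈ F.fns (h + 1), M.GoodTarget h g π) :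
    ⨅ a, M.optQ H 0 M.x₁ a ≤ M.optValue H := by
  have hmem := hBC.mem_optQ
  refine le_ciInf fun π => ?_
  rw [M.value_eq_sum, ← M.meanMin_zero_step π (F.measurable _ _ (hmem 0))]
  have hstep : ∀ h ∈ Finset.range H, M.meanMin π h (M.optQ H h) -
      M.meanMin π (h + 1) (M.optQ H (h + 1)) ≤ M.meanCost π h := by
    intro h hh
    have hh := Finset.mem_range.1 hh
    have h1 := M.meanMin_le π h (F.measurable _ _ (hmem h)) (F.mem_Icc _ _ (hmem h))
    have h2 := M.integral_bellman π h (F.measurable _ _ (hmem (h + 1)))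
      (F.mem_Icc _ _ (hmem (h + 1))) (hG π ⟨h, hh⟩ _ (hmem (h + 1)))
    rw [← M.optQ_eq hh] at h2
    linarith
  have := Finset.sum_le_sum hstep
  rw [Finset.sum_range_sub', hmem.terminal_eq, M.meanMin_zero, sub_zero] at this
  exact this

/-- Greediness turns the inequality `MDP.meanMin_le` into an equality, so the Bellman residuals of
`f` telescope along its own policy. -/
theorem IsGreedy.meanMin_eq [Fintype A] [Nonempty A]
    {M : MDP X A} {f : QTuple X A} {π : Policy X A}
    (hπ : IsGreedy H f π) {h : ℕ} (hh : h < H) (hf : Measurable (Function.uncurry (f h)))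
    (hfI : ∀ x a, f h x a ∈ Set.Icc (0 : ℝ) 1) :
    M.meanMin π h (f h) = ∫ z, f h z.1 z.2 ∂(M.stateActionDist π h) := by
  obtain ⟨g, hg, hk, hmin⟩ := hπ h hh
  rw [M.integral_stateActionDist_deterministic π h hg hk hf 1 fun x a => by
    rw [abs_of_nonneg (hfI x a).1]; exact (hfI x a).2, MDP.meanMin]
  exact integral_congr_ae (ae_of_all _ fun x => iInf_action_eq (hmin x))

theorem abs_integral_sub_bellman_le {F : FunClass X A H} {M : MDP X A} (hBC : F.BellmanComplete M)
    {f : QTuple X A} (hf : F.Mem f) (π : Policy X A) {h : ℕ} (hh : h < H) {η : ℝ} (hη : 0 < η) :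
    |∫ z, f h z.1 z.2 ∂(M.stateActionDist π h) -
        ∫ z, M.bellman h (f (h + 1)) z.1 z.2 ∂(M.stateActionDist π h)| ≤
      η * (∫ z, f h z.1 z.2 ∂(M.stateActionDist π h) +
        ∫ z, M.bellman h (f (h + 1)) z.1 z.2 ∂(M.stateActionDist π h)) +
      M.meanError π f h / η := by
  have hb := hBC h hh _ (hf (h + 1))
  have hpI := F.mem_Icc _ _ (hf h)
  have hqI := F.mem_Icc _ _ hb
  have hp : Integrable (fun z : X × A => f h z.1 z.2) (M.stateActionDist π h) :=
    integrable_of_mem_Icc (F.measurable _ _ (hf h)) fun z => hpI _ _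
  have hq : Integrable (fun z : X × A => M.bellman h (f (h + 1)) z.1 z.2)
      (M.stateActionDist π h) :=
    integrable_of_mem_Icc (F.measurable _ _ hb) fun z => hqI _ _
  have he : Integrable (fun z : X × A => M.berError f h z.1 z.2) (M.stateActionDist π h) :=
    integrable_of_mem_Icc (hBC.measurable_berError hf hh) fun z => hBC.berError_mem hf hh _ _
  have hpq : Integrable (fun z : X × A => f h z.1 z.2 + M.bellman h (f (h + 1)) z.1 z.2)
      (M.stateActionDist π h) := hp.add hq
  rw [← integral_sub hp hq, ← integral_add hp hq, ← integral_const_mul, MDP.meanError,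
    ← integral_div, ← integral_add (hpq.const_mul η) (he.div_const η)]
  refine (abs_integral_le_integral_abs).trans ?_
  refine integral_mono (hp.sub hq).abs ((hpq.const_mul η).add (he.div_const η)) fun z => ?_
  exact abs_sub_le_hellBerSq (hpI _ _).1 (hqI _ _).1 hη

end Regret

/-! ### Real-variable inequalities behind the small-cost rate. -/

section SelfBounding

/-- With `t = 1/H ≤ 1`, one has `(1 + t/4) ≤ (1 - t/4)(1 + t)` and `4 ≤ 6(1 - t/4)`; these explain
the weight `1/(4H)` and the constant 6. -/
theorem le_of_relative_error {u v Δ H : ℝ} (hH : 1 ≤ H)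
    (h : |u - v| ≤ 1 / (4 * H) * (u + v) + Δ / (1 / (4 * H))) (hv : 0 ≤ v) (hΔ : 0 ≤ Δ) :
    u ≤ (1 + 1 / H) * v + 6 * H * Δ := by
  have h1 := (le_abs_self _).trans h
  have hH0 : 0 < H := by linarith
  have e1 : Δ / (1 / (4 * H)) = 4 * H * Δ := by field_simp
  have e2 : 1 / (4 * H) = (1 / H) / 4 := by field_simp
  obtain ⟨t, ht⟩ : ∃ t, t = 1 / H := ⟨_, rfl⟩
  have ht0 : 0 < t := ht ▸ by positivity
  have ht1 : t ≤ 1 := by rw [ht, div_le_one hH0]; exact hH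
  rw [e1, e2, ← ht] at h1
  rw [← ht]
  have hHΔ : 0 ≤ H * Δ := by positivity
  have h2 : (1 - t / 4) * u ≤ (1 + t / 4) * v + 4 * H * Δ := by linarith
  have h3 : (1 + t / 4) * v + 4 * H * Δ ≤ (1 - t / 4) * ((1 + t) * v + 6 * H * Δ) := by
    nlinarith [mul_nonneg (mul_nonneg ht0.le (sub_nonneg.2 ht1)) hv,
      mul_nonneg (sub_nonneg.2 ht1) hHΔ, mul_nonneg ht0.le hv]
  exact le_of_mul_le_mul_left (h2.trans h3) (by linarith)

/-- The inequality `herr` is used twice: at weight `1/(4H)` to bound every `u h` by total cost and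
error, then at the free `η` to bound the residuals. -/
theorem sum_sub_le_of_relative_error {H : ℕ} (hH : 1 ≤ H) (u v c Δ : ℕ → ℝ) (hc : ∀ h, 0 ≤ c h)
    (hu : ∀ h, 0 ≤ u h) (hΔ : ∀ h, 0 ≤ Δ h) (hv : ∀ h < H, v h = c h + u (h + 1)) (hend : u H = 0)
    (herr : ∀ h < H, ∀ η : ℝ, 0 < η → |u h - v h| ≤ η * (u h + v h) + Δ h / η) {η : ℝ}
    (hη : 0 < η) :
    ∑ h ∈ Finset.range H, (v h - u h) ≤
      η * H * (7 * ∑ h ∈ Finset.range H, c h + 36 * H * ∑ h ∈ Finset.range H, Δ h) +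
        (∑ h ∈ Finset.range H, Δ h) / η := by
  have hH1 : (1 : ℝ) ≤ H := by exact_mod_cast hH
  have hH0 : (0 : ℝ) < H := by linarith
  set r : ℝ := 1 + 1 / H with hr
  have hr1 : 1 ≤ r := by rw [hr]; have : (0 : ℝ) < 1 / H := by positivity
                         linarith
  set w : ℕ → ℝ := fun h => c h + 6 * H * Δ h with hw
  have hw0 : ∀ h, 0 ≤ w h := fun h => by
    have := hc h; have := hΔ h; simp only [hw]; positivity
  have hgrow : ∀ n ≤ H, u (H - n) ≤ r ^ n * ∑ h ∈ Finset.Ico (H - n) H, w h := by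
    intro n
    induction n with
    | zero => intro _; simp [hend]
    | succ n ih =>
      intro hn
      have ih := ih (by omega)
      have hk : H - n = H - (n + 1) + 1 := by omega
      set j := H - (n + 1) with hj
      have hjH : j < H := by omega
      rw [hk] at ih
      have hv0 : 0 ≤ v j := by rw [hv j hjH]; exact add_nonneg (hc _) (hu _)
      have h1 := le_of_relative_error hH1 (herr j hjH (1 / (4 * H)) (by positivity)) hv0 (hΔ j)
      rw [Finset.sum_eq_sum_Ico_succ_bot hjH, pow_succ]
      have hS : 0 ≤ ∑ h ∈ Finset.Ico (j + 1) H, w h := Finset.sum_nonneg fun h _ => hw0 h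
      have hrn : 1 ≤ r ^ n := one_le_pow₀ hr1
      have h2 : 6 * H * Δ j ≤ r * (6 * H * Δ j) :=
        le_mul_of_one_le_left (by have := hΔ j; positivity) hr1
      calc u j ≤ r * v j + 6 * H * Δ j := h1
        _ ≤ r * (w j + u (j + 1)) := by rw [hv j hjH]; simp only [hw]; linarith
        _ ≤ r * (r ^ n * w j + r ^ n * ∑ h ∈ Finset.Ico (j + 1) H, w h) := by
            have := le_mul_of_one_le_left (hw0 j) hrn
            gcongr
        _ = _ := by ring
  -- A relative loss of `1/H` per step compounds to at most `e` over the horizon.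
  have hr3 : ∀ n ≤ H, r ^ n ≤ 3 := by
    intro n hn
    calc r ^ n ≤ r ^ H := pow_le_pow_right₀ hr1 hn
      _ ≤ Real.exp (1 / H) ^ H := by
          gcongr
          rw [hr, add_comm]; exact Real.add_one_le_exp _
      _ = Real.exp 1 := by rw [← Real.exp_nat_mul]; congr 1; field_simp
      _ ≤ 3 := Real.exp_one_lt_three.le
  set C := ∑ h ∈ Finset.range H, c h with hC
  set D := ∑ h ∈ Finset.range H, Δ h with hD
  have hW : ∑ h ∈ Finset.range H, w h = C + 6 * H * D := by
    rw [hC, hD, Finset.mul_sum, ← Finset.sum_add_distrib]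
  have hC0 : 0 ≤ C := Finset.sum_nonneg fun h _ => hc h
  have hD0 : 0 ≤ D := Finset.sum_nonneg fun h _ => hΔ h
  have hub : ∀ h ≤ H, u h ≤ 3 * (C + 6 * H * D) := by
    intro h hh
    have h1 := hgrow (H - h) (by omega)
    rw [show H - (H - h) = h by omega] at h1
    refine h1.trans (mul_le_mul (hr3 _ (by omega)) ?_ (Finset.sum_nonneg fun h _ => hw0 h)
      (by norm_num))
    rw [← hW, Finset.range_eq_Ico]
    exact Finset.sum_le_sum_of_subset_of_nonneg (Finset.Ico_subset_Ico_left (Nat.zero_le _))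
      fun i _ _ => hw0 i
  have hterm : ∀ h ∈ Finset.range H, v h - u h ≤ η * (7 * C + 36 * H * D) + Δ h / η := by
    intro h hh
    have hh' := Finset.mem_range.1 hh
    have h1 := (neg_le_abs _).trans (herr h hh' η hη)
    -- Since `v h` is a cost plus the next `u`, this is two bounds `3(C + 6HD)` plus one `C`.
    have h2 : u h + v h ≤ 7 * C + 36 * H * D := by
      have h3 := hub h hh'.le
      have h4 := hub (h + 1) hh'
      have h5 : c h ≤ C := Finset.single_le_sum (fun i _ => hc i) hh
      rw [hv h hh']
      linarith
    have := mul_le_mul_of_nonneg_left h2 hη.le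
    linarith
  refine (Finset.sum_le_sum hterm).trans (le_of_eq ?_)
  rw [Finset.sum_add_distrib, ← Finset.sum_div, Finset.sum_const, Finset.card_range, nsmul_eq_mul]
  ring

/-- Here `x` plays `K V^⋆` and `R` the regret. For `ηH ≤ 1/14` the term `7ηHR` is at most `R/2` and
moves to the left. -/
theorem le_sqrt_add_of_forall_le {H B x R D : ℝ} (hH : 1 ≤ H) (hB : 0 < B) (hx : 0 ≤ x)
    (hD : D ≤ H * B) (hR0 : 0 ≤ R)
    (hR : ∀ η : ℝ, 0 < η → R ≤ η * H * (7 * (R + x) + 36 * H * D) + D / η) :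
    R ≤ 16 * H * √(B * x) + 34 * H ^ 2 * B := by
  have hH0 : 0 < H := by linarith
  have key : ∀ η : ℝ, 0 < η → η * H ≤ 1 / 14 →
      R ≤ 14 * (η * H) * x + 6 * H ^ 2 * B + 2 * (H * B / η) := by
    intro η hη hηH
    have h1 := hR η hη
    have h2 : D / η ≤ H * B / η := by gcongr
    have h3 : η * H * (7 * (R + x) + 36 * H * D) ≤
        1 / 2 * R + 7 * (η * H) * x + 3 * H ^ 2 * B := by
      have e1 : η * H * R ≤ 1 / 14 * R := mul_le_mul_of_nonneg_right hηH hR0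
      have e2 : η * H * (H * D) ≤ η * H * (H * (H * B)) := by gcongr
      have e3 : η * H * (H * (H * B)) ≤ 1 / 14 * (H * (H * B)) :=
        mul_le_mul_of_nonneg_right hηH (by positivity)
      have e4 : 0 ≤ H * (H * B) := by positivity
      nlinarith
    linarith
  have hs := Real.sqrt_nonneg (B * x)
  have hHB : 0 < H ^ 2 * B := by positivity
  -- The optimal `η = √(B/x)` is admissible exactly in this case, as `196 = 14²`. Otherwise the
  -- largest admissible `η` is used, and `x ≤ 14H√(Bx)`.
  by_cases hcase : 196 * H ^ 2 * B ≤ x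
  · have hx0 : 0 < x := lt_of_lt_of_le (by positivity) hcase
    have hη : 0 < √(B / x) := Real.sqrt_pos.2 (by positivity)
    have hsx : √(B / x) * x = √(B * x) := by
      rw [Real.sqrt_div hB.le, Real.sqrt_mul hB.le, div_mul_eq_mul_div, div_eq_iff
        (Real.sqrt_pos.2 hx0).ne', mul_assoc, Real.mul_self_sqrt hx0.le]
    have hBs : B / √(B / x) = √(B * x) := by
      rw [div_eq_iff hη.ne', ← Real.sqrt_mul (by positivity),
        show B * x * (B / x) = B * B by field_simp, Real.sqrt_mul_self hB.le]
    have hsmall : √(B / x) * H ≤ 1 / 14 := by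
      have : √(B / x) ≤ 1 / (14 * H) := by
        rw [Real.sqrt_le_left (by positivity), div_le_iff₀ hx0, div_pow, one_pow, div_mul_eq_mul_div,
          le_div_iff₀ (by positivity)]
        nlinarith
      calc _ ≤ 1 / (14 * H) * H := by gcongr
        _ = 1 / 14 := by field_simp
    have h1 := key _ hη hsmall
    have h2 : 14 * (√(B / x) * H) * x = 14 * H * √(B * x) := by rw [← hsx]; ring
    have h3 : H * B / √(B / x) = H * √(B * x) := by rw [mul_div_assoc, hBs]
    rw [h2, h3] at h1
    linarith
  · push Not at hcase
    have h1 := key (1 / (14 * H)) (by positivity) (le_of_eq (by field_simp))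
    have h2 : 14 * (1 / (14 * H) * H) * x = x := by field_simp
    have h3 : H * B / (1 / (14 * H)) = 14 * H ^ 2 * B := by field_simp
    rw [h2, h3] at h1
    have h4 : x ≤ 14 * H * √(B * x) := by
      refine Real.le_sqrt_of_sq_le (x := x) (y := (14 * H) ^ 2 * (B * x)) ?_ |>.trans_eq ?_
      · nlinarith
      · rw [Real.sqrt_mul (by positivity), Real.sqrt_sq (by positivity)]
    have : H * √(B * x) ≥ 0 := by positivity
    linarith

end SelfBounding

/-! ### The degenerate class and the lower bound on the complexity. -/

section Complexity

variable {X A : Type*} [MeasurableSpace X] [MeasurableSpace A] {H : ℕ}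

/-- Both `f h` and its backup lie in a one-element factor. This covers the only case in which `β`
may fall below 1, where the pigeonhole bound does not apply. -/
theorem FunClass.BellmanComplete.meanError_eq_zero_of_card_eq_one {F : FunClass X A H}
    {M : MDP X A} (hBC : F.BellmanComplete M) {f : QTuple X A} (hf : F.Mem f) (π : Policy X A)
    {h : ℕ} (hh : h < H) (hcard : F.card = 1) : M.meanError π f h = 0 := by
  have h1 : (F.fns h).card = 1 := by
    rw [FunClass.card, Finset.prod_eq_one_iff_of_one_le' fun i _ => hBC.card_pos i] at hcard
    exact hcard h (Finset.mem_range.2 hh)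
  have : f h = M.bellman h (f (h + 1)) :=
    Finset.card_le_one.1 h1.le _ (hf h) _ (hBC h hh _ (hf (h + 1)))
  simp [MDP.meanError, MDP.berError, ← this, hellBerSq_self]

theorem one_le_complexity [Fintype A] [Nonempty A] {F : FunClass X A H} {M : MDP X A}
    {K : ℕ} {UA : Bool} {d : ℕ} (hd : (d : ℕ∞) = complexity M F K UA) : 1 ≤ d := by
  have : (1 : ℕ∞) ≤ d := by
    rw [hd, complexity]
    split_ifs
    · exact one_le_mul (by exact_mod_cast Fintype.card_pos (α := A)) (le_max_left _ _)
    · exact le_max_left _ _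
  exact_mod_cast this

end Complexity

/-! ### Assembling the regret bound. -/

section RegretBound

variable {X A : Type*} [MeasurableSpace X] [MeasurableSpace A] [MeasurableSingletonClass A]
  [Fintype A] [Nonempty A] {H : ℕ}

/-- The left side is the telescoped sum of on-policy Bellman residuals, to which
`sum_sub_le_of_relative_error` applies. -/
theorem IsGreedy.value_sub_le {F : FunClass X A H} {M : MDP X A} (hH : 1 ≤ H)
    (hBC : F.BellmanComplete M)
    (hG : ∀ π : Policy X A, ∀ h : Fin H, ∀ g ∈ F.fns (h + 1), M.GoodTarget h g π)
    {f : QTuple X A} (hf : F.Mem f) {π : Policy X A} (hπ : IsGreedy H f π) {η : ℝ} (hη : 0 < η) :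
    M.value H π - ⨅ a, f 0 M.x₁ a ≤
      η * H * (7 * M.value H π + 36 * H * ∑ h ∈ Finset.range H, M.meanError π f h) +
        (∑ h ∈ Finset.range H, M.meanError π f h) / η := by
  have hv : ∀ h < H, ∫ z, M.bellman h (f (h + 1)) z.1 z.2 ∂(M.stateActionDist π h) =
      M.meanCost π h + M.meanMin π (h + 1) (f (h + 1)) := fun h hh =>
    M.integral_bellman π h (F.measurable _ _ (hf _)) (F.mem_Icc _ _ (hf _))
      (hG π ⟨h, hh⟩ _ (hf _))
  have hend : M.meanMin π H (f H) = 0 := by rw [hf.terminal_eq, M.meanMin_zero]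
  have hmain := sum_sub_le_of_relative_error hH (fun h => M.meanMin π h (f h))
    (fun h => ∫ z, M.bellman h (f (h + 1)) z.1 z.2 ∂(M.stateActionDist π h))
    (M.meanCost π) (M.meanError π f) (M.meanCost_nonneg π)
    (fun h => M.meanMin_nonneg π h (F.mem_Icc _ _ (hf h))) (M.meanError_nonneg π f) hv hend
    (fun h hh η hη => by
      simp only [hπ.meanMin_eq hh (F.measurable _ _ (hf h)) (F.mem_Icc _ _ (hf h))]
      exact abs_integral_sub_bellman_le hBC hf π hh hη) hη
  rw [← M.value_eq_sum] at hmain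
  refine le_trans (le_of_eq ?_) hmain
  rw [Finset.sum_congr rfl (g := fun h => M.meanCost π h -
      (M.meanMin π h (f h) - M.meanMin π (h + 1) (f (h + 1))))
      fun h hh => by rw [hv h (Finset.mem_range.1 hh)]; ring,
    Finset.sum_sub_distrib, Finset.sum_range_sub', hend, sub_zero, ← M.value_eq_sum,
    M.meanMin_zero_step π (F.measurable _ _ (hf 0))]

/-- The pigeonhole bound on the Bellman errors of a sequence of tuples that fit the data of the
preceding rounds. -/
theorem sum_meanError_le {F : FunClass X A H} {M : MDP X A} (hBC : F.BellmanComplete M) {K : ℕ}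
    (hK : 1 ≤ K) {UA : Bool} {d : ℕ} (hd : (d : ℕ∞) = complexity M F K UA) {β : ℝ} (hβ : 1 ≤ β)
    (f : ℕ → QTuple X A) (π : ℕ → Policy X A) (hf : ∀ k < K, F.Mem (f k))
    (hπ : ∀ k < K, IsGreedy H (f k) (π k)) {h : ℕ} (hh : h < H)
    (hsum : ∀ k < K, ∑ i ∈ Finset.range k, M.hellError UA h (f k h) (f k (h + 1)) (π i) ≤ β) :
    ∑ k ∈ Finset.range K, M.meanError (π k) (f k) h ≤ 6 * (d * β * (1 + Real.log K)) := by
  have hmeas : ∀ k < K, Measurable (Function.uncurry (M.berError (f k) h)) :=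
    fun k hk => hBC.measurable_berError (hf k hk) hh
  have hmem : ∀ k < K, ∀ x a, M.berError (f k) h x a ∈ Set.Icc (0 : ℝ) 1 :=
    fun k hk => hBC.berError_mem (hf k hk) hh
  have habs : ∀ k < K, ∀ x a, |M.berError (f k) h x a| ≤ 1 := fun k hk x a => by
    rw [abs_of_nonneg (hmem k hk x a).1]; exact (hmem k hk x a).2
  cases UA with
  | false =>
    simp only [complexity, Bool.false_eq_true, if_false] at hd
    have hN : eluderDim 1 {ψ : X × A → ℝ | ∃ f, F.Mem f ∧ ψ = fun z => M.berError f h z.1 z.2}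
        {μ | ∃ π : Policy X A, μ = M.stateActionDist π h} (1 / (K : ℝ)) ≤ d := by
      rw [hd]
      exact le_trans (le_iSup (fun h : Fin H => eluderDim 1
        {ψ : X × A → ℝ | ∃ f, F.Mem f ∧ ψ = fun z => M.berError f h z.1 z.2}
        {μ | ∃ π : Policy X A, μ = M.stateActionDist π h} (1 / (K : ℝ))) ⟨h, hh⟩)
        (le_max_right _ _)
    have hN1 : 1 ≤ d := by
      have : (1 : ℕ∞) ≤ d := by rw [hd]; exact le_max_left _ _
      exact_mod_cast this
    have hnn : ∀ k i, |∫ z, M.berError (f k) h z.1 z.2 ∂(M.stateActionDist (π i) h)| =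
        M.meanError (π i) (f k) h := fun k i => abs_of_nonneg (M.meanError_nonneg _ _ _)
    have := sum_abs_le_of_eluderDim_le hK hN hN1 hβ (fun k => M.stateActionDist (π k) h)
      (fun k z => M.berError (f k) h z.1 z.2) (fun k _ => ⟨π k, rfl⟩)
      (fun k hk => ⟨f k, hf k hk, rfl⟩) (fun k hk => by
        simp only [hnn]; exact hsum k hk) fun k hk => by
        refine (abs_integral_le_integral_abs).trans ?_
        refine (integral_mono_of_nonneg (ae_of_all _ fun _ => abs_nonneg _) (integrable_const 1)
          (ae_of_all _ fun z : X × A => habs k hk z.1 z.2)).trans ?_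
        simp
    simpa only [hnn] using this
  | true =>
    simp only [complexity, if_true] at hd
    have hA : 1 ≤ Fintype.card A := Fintype.card_pos
    have hA0 : (0 : ℝ) < Fintype.card A := by exact_mod_cast hA
    obtain ⟨N, hN⟩ : ∃ N : ℕ, (N : ℕ∞) = max 1 (dBceV M F K) := by
      -- An infinite dimension times the positive number of actions would be infinite, contradicting
      -- finiteness of `d`.
      refine ⟨(max 1 (dBceV M F K)).toNat, ENat.natCast_toNat fun htop => ?_⟩
      rw [htop, ENat.mul_top (by exact_mod_cast (by omega))] at hd
      exact ENat.natCast_ne_top d hd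
    have hdN : d = Fintype.card A * N := by rw [← hN] at hd; exact_mod_cast hd
    have hNe : eluderDim 1 {ψ : X → ℝ | ∃ f, F.Mem f ∧
        ψ = fun x => (∑ a, M.berError f h x a) / Fintype.card A}
        {μ | ∃ π : Policy X A, μ = M.stateDist π h} (1 / (K : ℝ)) ≤ N := by
      rw [hN]
      exact le_trans (le_iSup (fun h : Fin H => eluderDim 1
        {ψ : X → ℝ | ∃ f, F.Mem f ∧ ψ = fun x => (∑ a, M.berError f h x a) / Fintype.card A}
        {μ | ∃ π : Policy X A, μ = M.stateDist π h} (1 / (K : ℝ))) ⟨h, hh⟩) (le_max_right _ _)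
    have hN1 : 1 ≤ N := by
      have : (1 : ℕ∞) ≤ N := by rw [hN]; exact le_max_left _ _
      exact_mod_cast this
    have hnn : ∀ k < K, ∀ x, 0 ≤ (∑ a, M.berError (f k) h x a) / Fintype.card A := fun k hk x =>
      div_nonneg (Finset.sum_nonneg fun a _ => (hmem k hk x a).1) hA0.le
    have hle1 : ∀ k < K, ∀ x, (∑ a, M.berError (f k) h x a) / Fintype.card A ≤ 1 := by
      intro k hk x
      rw [div_le_one hA0]
      refine (Finset.sum_le_sum fun a _ => (hmem k hk x a).2).trans (le_of_eq ?_)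
      simp
    have hEq : ∀ k < K, ∀ i, |∫ x, (∑ a, M.berError (f k) h x a) / Fintype.card A
        ∂(M.stateDist (π i) h)| = M.hellError true h (f k h) (f k (h + 1)) (π i) := by
      intro k hk i
      rw [abs_of_nonneg (integral_nonneg (hnn k hk)),
        ← M.integral_stateActionDist_unifAt (π i) h (hmeas k hk) 1 (habs k hk)]
      rfl
    have := sum_abs_le_of_eluderDim_le hK hNe hN1 hβ (fun k => M.stateDist (π k) h)
      (fun k x => (∑ a, M.berError (f k) h x a) / Fintype.card A) (fun k _ => ⟨π k, rfl⟩)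
      (fun k hk => ⟨f k, hf k hk, rfl⟩) (fun k hk => by
        simp only [hEq k hk]; exact hsum k hk) fun k hk => by
        rw [abs_of_nonneg (integral_nonneg (hnn k hk))]
        refine (integral_mono_of_nonneg (ae_of_all _ (hnn k hk)) (integrable_const 1)
          (ae_of_all _ (hle1 k hk))).trans ?_
        simp
    -- The error at the greedy action is one nonnegative term of the sum over actions, so passing to
    -- the uniform average costs the factor `A`.
    have hstep : ∀ k ∈ Finset.range K, M.meanError (π k) (f k) h ≤ Fintype.card A *
        |∫ x, (∑ a, M.berError (f k) h x a) / Fintype.card A ∂(M.stateDist (π k) h)| := by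
      intro k hk
      have hk := Finset.mem_range.1 hk
      obtain ⟨g, hg, hker, -⟩ := hπ k hk h hh
      have hms : Measurable fun x => ∑ a, M.berError (f k) h x a :=
        Finset.measurable_fun_sum _ fun a _ => (hmeas k hk).comp
          (g := Function.uncurry (M.berError (f k) h)) (f := fun x => (x, a)) (by fun_prop)
      rw [MDP.meanError, M.integral_stateActionDist_deterministic (π k) h hg hker
        (hmeas k hk) 1 (habs k hk), abs_of_nonneg (integral_nonneg (hnn k hk)),
        integral_div, mul_div_cancel₀ _ hA0.ne']
      refine integral_mono_of_nonneg (ae_of_all _ fun x => (hmem k hk x _).1) ?_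
        (ae_of_all _ fun x => ?_)
      · have : Integrable (fun x => (∑ a, M.berError (f k) h x a) / Fintype.card A)
            (M.stateDist (π k) h) :=
          integrable_of_mem_Icc (hms.div_const _) fun x => ⟨hnn k hk x, hle1 k hk x⟩
        simpa [div_mul_cancel₀ _ hA0.ne'] using this.mul_const (Fintype.card A : ℝ)
      · exact Finset.single_le_sum (f := fun a => M.berError (f k) h x a)
          (fun a _ => (hmem k hk x a).1) (Finset.mem_univ (g x))
    calc _ ≤ ∑ k ∈ Finset.range K, Fintype.card A *
          |∫ x, (∑ a, M.berError (f k) h x a) / Fintype.card A ∂(M.stateDist (π k) h)| :=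
          Finset.sum_le_sum hstep
      _ ≤ Fintype.card A * (6 * (N * β * (1 + Real.log K))) := by
          rw [← Finset.mul_sum]
          gcongr
      _ = _ := by rw [hdN]; push_cast; ring

theorem regret_le_of_lossesCompare {F : FunClass X A H} {M : MDP X A} {K : ℕ} {UA : Bool}
    (hH : 1 ≤ H) (hK : 1 ≤ K) (hBC : F.BellmanComplete M)
    (hG : ∀ π : Policy X A, ∀ h : Fin H, ∀ g ∈ F.fns (h + 1), M.GoodTarget h g π)
    {d : ℕ} (hd : (d : ℕ∞) = complexity M F K UA) {β : ℝ} (hβ0 : 0 < β)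
    (hβ : 1 ≤ β ∨ F.card = 1)
    (f : ℕ → QTuple X A) (π : ℕ → Policy X A) (D : ℕ → Fin H → Obs X A)
    (hf : ∀ k < K, f k ∈ versionSpace F bceLoss β D k)
    (hopt : ∀ k < K, ∀ g ∈ versionSpace F bceLoss β D k,
      ⨅ a, f k 0 M.x₁ a ≤ ⨅ a, g 0 M.x₁ a)
    (hπ : ∀ k < K, IsGreedy H (f k) (π k))
    (hL : ∀ h : Fin H, ∀ g ∈ F.fns h, ∀ g' ∈ F.fns (h + 1),
      LossesCompare M β K UA π D h g g') :
    ∑ k ∈ Finset.range K, (M.value H (π k) - M.optValue H) ≤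
      204 * (1 + Real.log K) *
        (H * √(M.optValue H * K * d * β) + (H : ℝ) ^ 2 * d * β) := by
  have hH1 : (1 : ℝ) ≤ H := by exact_mod_cast hH
  have hd1 : (1 : ℝ) ≤ d := by exact_mod_cast one_le_complexity hd
  have hlog : 0 ≤ Real.log K := Real.log_nonneg (by exact_mod_cast hK)
  have hV := M.optValue_nonneg H
  -- The optimal `Q`-function is its own backup, so the first half of `LossesCompare` is precisely
  -- its membership condition.
  have hQ : ∀ k < K, M.optQ H ∈ versionSpace F bceLoss β D k := by
    refine fun k hk => ⟨hBC.mem_optQ, fun h g hg => ?_⟩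
    have := (hL h g hg _ (hBC.mem_optQ (h + 1)) k hk.le).1
    rwa [← M.optQ_eq h.2] at this
  have hoptimism : ∀ k < K, ⨅ a, f k 0 M.x₁ a ≤ M.optValue H := fun k hk =>
    (hopt k hk _ (hQ k hk)).trans (hBC.iInf_optQ_le hG)
  have hfit : ∀ h < H, ∀ k < K,
      ∑ i ∈ Finset.range k, M.hellError UA h (f k h) (f k (h + 1)) (π i) ≤ β := by
    intro h hh k hk
    obtain ⟨hmem, hvs⟩ := hf k hk
    exact (hL ⟨h, hh⟩ _ (hmem h) _ (hmem (h + 1)) k hk.le).2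
      (hvs ⟨h, hh⟩ _ (hBC h hh _ (hmem (h + 1))))
  set L := 1 + Real.log K with hLdef
  have hL1 : 1 ≤ L := by linarith
  have hB : 0 < 6 * (d * β * L) := by positivity
  have hstep : ∀ h < H, ∑ k ∈ Finset.range K, M.meanError (π k) (f k) h ≤ 6 * (d * β * L) := by
    intro h hh
    rcases hβ with hβ | hcard
    · exact sum_meanError_le hBC hK hd hβ f π (fun k hk => (hf k hk).1) hπ hh (hfit h hh)
    · rw [Finset.sum_eq_zero fun k hk => hBC.meanError_eq_zero_of_card_eq_one
        (hf k (Finset.mem_range.1 hk)).1 (π k) hh hcard]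
      exact hB.le
  set Δ : ℕ → ℝ := fun k => ∑ h ∈ Finset.range H, M.meanError (π k) (f k) h with hΔ
  have hD : ∑ k ∈ Finset.range K, Δ k ≤ H * (6 * (d * β * L)) := by
    rw [hΔ, Finset.sum_comm]
    refine (Finset.sum_le_sum fun h hh => hstep h (Finset.mem_range.1 hh)).trans (le_of_eq ?_)
    rw [Finset.sum_const, Finset.card_range, nsmul_eq_mul]
  have hR := le_sqrt_add_of_forall_le (x := K * M.optValue H)
    (R := ∑ k ∈ Finset.range K, (M.value H (π k) - M.optValue H)) hH1 hB (by positivity) hD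
    (Finset.sum_nonneg fun k _ => sub_nonneg.2 (M.optValue_le H (π k))) (fun η hη => by
      have hsum : ∑ k ∈ Finset.range K, (M.value H (π k) - M.optValue H) + K * M.optValue H =
          ∑ k ∈ Finset.range K, M.value H (π k) := by
        rw [Finset.sum_sub_distrib, Finset.sum_const, Finset.card_range, nsmul_eq_mul]
        ring
      calc _ ≤ ∑ k ∈ Finset.range K,
            (η * H * (7 * M.value H (π k) + 36 * H * Δ k) + Δ k / η) := by
            refine Finset.sum_le_sum fun k hk => ?_
            have hk := Finset.mem_range.1 hk
            have := (hπ k hk).value_sub_le hH hBC hG (hf k hk).1 hη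
            linarith [hoptimism k hk]
        _ = _ := by
            rw [hsum, Finset.sum_add_distrib, ← Finset.mul_sum, Finset.sum_add_distrib,
              ← Finset.mul_sum, ← Finset.mul_sum, Finset.sum_div])
  -- As `6L ≥ 1`, the factor may be squared under the root. The final constant is `34 * 6 = 204`,
  -- which also covers `16 * 6`.
  have hsqrt : √(6 * (d * β * L) * (K * M.optValue H)) ≤ 6 * L * √(M.optValue H * K * d * β) := by
    have h1 : 6 * L * √(M.optValue H * K * d * β) =
        √((6 * L) ^ 2 * (M.optValue H * K * d * β)) := by
      rw [Real.sqrt_mul (sq_nonneg (6 * L)), Real.sqrt_sq (by positivity)]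
    rw [h1]
    refine Real.sqrt_le_sqrt ?_
    have h2 : 0 ≤ M.optValue H * K * d * β := by positivity
    calc _ = 6 * L * (M.optValue H * K * d * β) := by ring
      _ ≤ (6 * L) ^ 2 * (M.optValue H * K * d * β) := by
        gcongr
        nlinarith
  calc _ ≤ 16 * H * (6 * L * √(M.optValue H * K * d * β)) + 34 * H ^ 2 * (6 * (d * β * L)) := by
        refine hR.trans ?_
        gcongr
    _ ≤ _ := by
        have : 0 ≤ L * (H * √(M.optValue H * K * d * β)) := by positivity
        nlinarith

end RegretBound

end OnlineRL

end

/-! ### The theorem. -/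

theorem mainTheorem2 :
    ∃ Cst : ℝ, 0 < Cst ∧
      ∀ (X A Ω : Type*) [MeasurableSpace X]
        [MeasurableSpace A] [MeasurableSingletonClass A] [Fintype A] [Nonempty A]
        [mΩ : MeasurableSpace Ω] (μ : MeasureTheory.Measure Ω)
        [MeasureTheory.IsProbabilityMeasure μ] (ℱ : MeasureTheory.Filtration ℕ mΩ)
        (H K : ℕ) (_hH : 1 ≤ H) (_hK : 1 ≤ K) (UA : Bool)
        (M : OnlineRL.MDP X A) (F : OnlineRL.FunClass X A H)
        -- the cumulative cost of every policy lies in `[0,1]` almost surely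
        (_hZ : ∀ π : OnlineRL.Policy X A, ∀ᵐ τ ∂(M.rollIn H π),
          ∑ h, OnlineRL.Obs.cost (τ h) ∈ Set.Icc (0 : ℝ) 1)
        -- the regression targets (second argument of the bce loss) lie in `[0,1]` almost surely
        (_hτ : ∀ π : OnlineRL.Policy X A, ∀ h : Fin H, ∀ g ∈ F.fns (h + 1),
          ∀ᵐ τ ∂(M.rollIn H π),
            OnlineRL.target g (OnlineRL.Obs.cost (τ h)) (OnlineRL.Obs.next (τ h))
              ∈ Set.Icc (0 : ℝ) 1)
        (_hBC : F.BellmanComplete M)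
        (δ : ℝ) (_hδ : δ ∈ Set.Ioo (0 : ℝ) 1)
        (β : ℝ) (_hβ : β = 2 * Real.log (H * F.card / δ))
        (d : ℕ) (_hd : (d : ℕ∞) = OnlineRL.complexity M F K UA)
        (f : ℕ → Ω → OnlineRL.QTuple X A) (π : ℕ → Ω → OnlineRL.Policy X A)
        (D : ℕ → Ω → Fin H → OnlineRL.Obs X A)
        (_hrun : OnlineRL.IsRun μ ℱ M F OnlineRL.bceLoss β K UA f π D),
        μ {ω | ¬ (∑ k ∈ Finset.range K, (M.value H (π k ω) - M.optValue H) ≤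
            Cst * (1 + Real.log K) *
              (H * √(M.optValue H * K * d * β) + (H : ℝ) ^ 2 * d * β))}
          ≤ ENNReal.ofReal δ := by
  refine ⟨204, by norm_num, ?_⟩
  intro X A Ω _ _ _ _ _ mΩ μ _ ℱ H K hH hK UA M F _ hτ hBC δ hδ β hβ d hd f π D hrun
  have hcard : 1 ≤ F.card := Finset.one_le_prod' fun i _ => hBC.card_pos i
  have hH1 : (1 : ℝ) ≤ H := by exact_mod_cast hH
  have hF1 : (1 : ℝ) ≤ F.card := by exact_mod_cast hcard
  have hHF : (1 : ℝ) ≤ H * F.card := one_le_mul_of_one_le_of_one_le hH1 hF1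
  have hβ0 : 0 < β := by
    rw [hβ]
    have : 0 < Real.log (H * F.card / δ) := Real.log_pos (by
      rw [lt_div_iff₀ hδ.1, one_mul]; linarith [hδ.2])
    linarith
  -- With at least two tuples, `β ≥ 2 ln 2 > 1`.
  have hβ1 : 1 ≤ β ∨ F.card = 1 := by
    rcases hcard.eq_or_lt with h1 | h2
    · exact Or.inr h1.symm
    · left
      have hF2 : (2 : ℝ) ≤ F.card := by exact_mod_cast h2
      have : Real.log 2 ≤ Real.log (H * F.card / δ) := by
        refine Real.log_le_log two_pos ?_
        rw [le_div_iff₀ hδ.1]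
        nlinarith [hδ.1, hδ.2]
      rw [hβ]
      linarith [Real.log_two_gt_d9]
  refine le_trans (MeasureTheory.measure_mono ?_)
    (hrun.measure_exists_not_lossesCompare_le hH hτ hBC hδ.1)
  intro ω hω hL
  refine hω ?_
  rw [← hβ] at hL
  exact OnlineRL.regret_le_of_lossesCompare hH hK hBC (fun π h g hg => F.goodTarget hτ π h hg) hd
    hβ0 hβ1 (fun k => f k ω) (fun k => π k ω) (fun k => D k ω)
    (fun k hk => hrun.mem_versionSpace k hk ω) (fun k hk => hrun.optimistic k hk ω)
    (fun k hk => hrun.greedy k hk ω) hL
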